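/- **Theorem 7.11.** Fix a bijective pairing $J:\mathbb N\times\mathbb N\to\mathbb N$ (Cantor-type, as in `Nat.pair`) with projections $K,L$. Let $\mathcal F$ be a *universe of functions*: a set of functions $\mathbb N\to\mathbb N$ that contains the zero function, the successor function, $K$ and $L$, is closed under $(\alpha,\beta)\mapsto(n\mapsto J(\alpha(n),\beta(n)))$, under composition and under primitive recursion, and is closed under unbounded search: if $\alpha\in\mathcal F$ and $\forall m\,\exists n\;\alpha(J(m,n))=0$, then there is $\gamma\in\mathcal F$ with $\forall m\;\alpha(J(m,\gamma(m)))=0$. (For example, $\mathcal F$ may be the set of all functions, or the set of all computable functions. No axiom of choice for $\mathcal F$ beyond unbounded search is assumed.) *Notation.* Rational numbers, rational segments $s=\langle p,q\rangle$ with $p\le q$ (of length $q-p$), and pairs of segments are coded effectively by natural numbers. Write $\langle p,q\rangle\sqsubset\langle r,t\rangle$ if $r<p$ and $q<t$, and $\langle p,q\rangle\sqsubseteq\langle r,t\rangle$ if $r\le p$ and $q\le t$. Two segments *touch* if neither lies strictly to the left of the other. A *real number* is a function $x\in\mathcal F$ such that every $x(n)$ is a segment, $x(n+1)\sqsubset x(n)$,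 and for each $n$ some $x(p)$ has length at most $2^{-n}$. For reals, $x<y$ means that some $x(n)$ lies strictly to the left of $y(n)$; $x\le y$ means that no $x(n)$ lies strictly to the right of $y(n)$; $x=_{\mathbb R}y$ means $x\le y$ and $y\le x$; comparison with rational numbers and $|x-y|<q$ are defined correspondingly. Two sets of reals *really coincide* if every element of either one is $=_{\mathbb R}$ to an element of the other. A segment $s$ *contains* $x$ if $x(n)\sqsubset s$ for some $n$. For $\alpha\in\mathcal F$ put $\alpha^n(m)=\alpha(J(n,m))$. A set $H$ of reals is *closed-and-separable* if there is $\alpha\in\mathcal F$ such that every $\alpha^n$ is a real number and $H$ really coincides with the set of all reals $x$ such that for each $n$ there is $m$ for which $x(n)$ contains $\alpha^m$. For $\beta\in\mathcal F$ let $E_\beta=\{k:\exists m\;\beta(m)=k+1\}$ and $E_{\overline\beta(n)}=\{k:\exists m<n\;\beta(m)=k+1\}$. A set $B$ of segments *covers* $H$ if each $x\in H$ is contained in some $s\in B$. $H$ is *totally bounded* if for each $n$ a finite set of segments, each of length at most $2^{-n}$ and each containing an element of $H$, covers $H$. $H$ is *bounded from above* if some real $y$ satisfies $x\le y$ for all $x\in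 H$, and *bounded* if it is bounded from above and, likewise, from below. A real $y$ is a *least upper bound* of $H$ if it is an upper bound of $H$ and for each real $z<y$ there is $x\in H$ with $z<x$. $H$ *almost has a maximum* if it has a least upper bound $y$ such that every real $z$ with $x<z$ for all $x\in H$ satisfies $y<z$. A *partial continuous function* from $\mathbb R$ to $\mathbb R$ is a set $X$ of pairs of segments such that (for segments $r,s,t$) $\langle r,s\rangle\in X$ and $t\sqsubseteq r$ imply $\langle t,s\rangle\in X$; $\langle r,s\rangle\in X$ and $s\sqsubseteq t$ imply $\langle r,t\rangle\in X$; and $\langle r,s\rangle,\langle r,t\rangle\in X$ imply that $s$ and $t$ touch. $X$ *maps $x$ onto $y$* if for each $n$ there is $m$ with $\langle x(m),y(n)\rangle\in X$; the domain of $X$ is the set of reals that $X$ maps onto some real, and the range of $X$ is the set of reals onto which $X$ maps some real. An *enumerable continuous function from $H$ to $\mathbb R$* is a partial continuous function of the form $E_\phi$, $\phi\in\mathcal F$, whose domain really coincides with $H$ ("$\phi$ enumerates a continuous function from $H$ to $\mathbb R$"); $\phi(x)$ denotes the real, unique up to $=_{\mathbb R}$, onto which $E_\phi$ maps $x$. It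 is called totally bounded, bounded, bounded from above, or is said to have a least upper bound, or almost to have a maximum, if its range is or does so. It is *uniformly continuous on $H$* if for each $m$ there is $n$ such that for all $x,x'\in H$, $|x-x'|<2^{-n}$ implies $|\phi(x)-\phi(x')|<2^{-m}$. *Claim.* For every closed-and-separable set $H$ of real numbers the following are equivalent: (i) $H$ has the Heine–Borel property: for every $\beta\in\mathcal F$, if $E_\beta$ covers $H$, then $E_{\overline\beta(n)}$ covers $H$ for some $n$. (ii) Every enumerable continuous function from $H$ to $\mathbb R$ is totally bounded. (iii) $H$ is totally bounded and every enumerable continuous function from $H$ to $\mathbb R$ is uniformly continuous on $H$. (iv) $H$ is totally bounded and every bounded enumerable continuous function from $H$ to $\mathbb R$ is uniformly continuous on $H$. (v) Every enumerable continuous function from $H$ to $\mathbb R$ almost has a maximum. (vi) Every bounded enumerable continuous function from $H$ to $\mathbb R$ almost has a maximum. (vii) Every enumerable continuous function from $H$ to $\mathbb R$ has a least upper bound. (viii) Every enumerable continuous function from $H$ to $\mathbb R$ is bounded from above. (ix) For every $\phi\in\mathcal F$ enumerating a continuous function from $H$ to $\mathbb R$, if $\phi(x)>0$ for all $x\in H$,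 then there is $m$ such that $\phi(x)>2^{-m}$ for all $x\in H$. (x) For every $\phi\in\mathcal F$ enumerating a continuous function from $H$ to $\mathbb R$ that is uniformly continuous on $H$, if $\phi(x)>0$ for all $x\in H$, then there is $m$ such that $\phi(x)>2^{-m}$ for all $x\in H$. (xi) $H$ has Dini's property: for every $\phi\in\mathcal F$, if each $\phi^n$ enumerates a continuous function from $H$ to $\mathbb R$, and $\phi^n(x)\ge\phi^{n+1}(x)\ge 0$ for all $n$ and all $x\in H$, and for each $m$ and each $x\in H$ there is $n$ with $\phi^n(x)\le 2^{-m}$, then for each $m$ there is $n$ such that $\phi^n(x)\le 2^{-m}$ for all $x\in H$. -/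

import Mathlib

namespace BIM

/-! ### The universe of functions -/

/-- The axioms on the range `F` of the function variables: `F` contains the basic functions and
is closed under substitution, primitive recursion and unbounded search. `Nat.pair` is the
pairing function `J`, and a binary function is a unary function of the coded pair. The set of all
functions from `ℕ` to `ℕ` and the set of the computable functions are examples. -/
structure IsUniverse (F : Set (ℕ → ℕ)) : Prop where
  zero : (fun _ => 0) ∈ F
  succ : Nat.succ ∈ F
  left : (fun n => (Nat.unpair n).1) ∈ F
  right : (fun n => (Nat.unpair n).2) ∈ F
  pair : ∀ α ∈ F, ∀ β ∈ F, (fun n => Nat.pair (α n) (β n)) ∈ F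
  comp : ∀ α ∈ F, ∀ β ∈ F, (fun n => α (β n)) ∈ F
  prec : ∀ α ∈ F, ∀ β ∈ F, ∃ γ ∈ F, ∀ m n : ℕ,
    γ (Nat.pair m 0) = α m ∧
      γ (Nat.pair m (n + 1)) = β (Nat.pair (Nat.pair m n) (γ (Nat.pair m n)))
  search : ∀ α ∈ F, (∀ m, ∃ n, α (Nat.pair m n) = 0) →
    ∃ γ ∈ F, ∀ m, α (Nat.pair m (γ m)) = 0

/-- The `n`-th row `αⁿ` of `α`. -/
def row (α : ℕ → ℕ) (n : ℕ) : ℕ → ℕ := fun m => α (Nat.pair n m)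

/-- The set enumerated by `β`. -/
def enum (β : ℕ → ℕ) : Set ℕ := {k | ∃ m, β m = k + 1}

/-- The finite set enumerated by the first `n` values of `β`. -/
def enumUpTo (β : ℕ → ℕ) (n : ℕ) : Set ℕ := {k | ∃ m < n, β m = k + 1}

/-! ### Rational segments, coded by natural numbers -/

/-- The number `⟨⟨a, b⟩, d⟩` codes the rational number `(a - b) / (d + 1)`. -/
def ratOf (c : ℕ) : ℚ :=
  (((Nat.unpair (Nat.unpair c).1).1 : ℚ) - ((Nat.unpair (Nat.unpair c).1).2 : ℚ)) /
    (((Nat.unpair c).2 : ℚ) + 1)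

/-- Left endpoint of the segment coded by `s`. -/
def lo (s : ℕ) : ℚ := ratOf (Nat.unpair s).1

/-- Right endpoint of the segment coded by `s`. -/
def hi (s : ℕ) : ℚ := ratOf (Nat.unpair s).2

/-- `s` codes a rational segment. -/
def IsSeg (s : ℕ) : Prop := lo s ≤ hi s

def segLength (s : ℕ) : ℚ := hi s - lo s

/-- `s` is strictly included in `t`. -/
def StrictIn (s t : ℕ) : Prop := lo t < lo s ∧ hi s < hi t

/-- `s` is included in `t`. -/
def Included (s t : ℕ) : Prop := lo t ≤ lo s ∧ hi s ≤ hi t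

/-- `s` and `t` do not lie apart. -/
def Touches (s t : ℕ) : Prop := lo s ≤ hi t ∧ lo t ≤ hi s

/-! ### Real numbers -/

/-- `x` is a real number: a strictly shrinking, dwindling sequence of rational segments. -/
def IsReal (x : ℕ → ℕ) : Prop :=
  (∀ n, IsSeg (x n)) ∧ (∀ n, StrictIn (x (n + 1)) (x n)) ∧
    ∀ n : ℕ, ∃ p, segLength (x p) ≤ 1 / 2 ^ n

/-- The set of the real numbers of the universe `F`. -/
def Reals (F : Set (ℕ → ℕ)) : Set (ℕ → ℕ) := {x | x ∈ F ∧ IsReal x}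

def RLt (x y : ℕ → ℕ) : Prop := ∃ n, hi (x n) < lo (y n)

def RLe (x y : ℕ → ℕ) : Prop := ∀ n, lo (x n) ≤ hi (y n)

/-- The real numbers `x` and `y` really coincide. -/
def REq (x y : ℕ → ℕ) : Prop := RLe x y ∧ RLe y x

/-- `q < x`, for a rational `q` and a real number `x`. -/
def RatLt (q : ℚ) (x : ℕ → ℕ) : Prop := ∃ n, q < lo (x n)

/-- `q ≤ x`, for a rational `q` and a real number `x`. -/
def RatLe (q : ℚ) (x : ℕ → ℕ) : Prop := ∀ n, q ≤ hi (x n)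

/-- `x ≤ q`, for a rational `q` and a real number `x`. -/
def LeRat (x : ℕ → ℕ) (q : ℚ) : Prop := ∀ n, lo (x n) ≤ q

/-- `|x - y| < q`, for real numbers `x`, `y` and a rational `q`: some segment of the difference
`x - y` lies strictly between `-q` and `q`. -/
def DistLt (x y : ℕ → ℕ) (q : ℚ) : Prop :=
  ∃ n, hi (x n) - lo (y n) < q ∧ hi (y n) - lo (x n) < q

/-- The segment `s` contains the real number `x`. -/
def Contains (s : ℕ) (x : ℕ → ℕ) : Prop := ∃ n, StrictIn (x n) s

/-! ### Sets of real numbers -/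

def RSubset (X Y : Set (ℕ → ℕ)) : Prop := ∀ x ∈ X, ∃ y ∈ Y, REq x y

/-- `X` and `Y` really coincide. -/
def RCoincide (X Y : Set (ℕ → ℕ)) : Prop := RSubset X Y ∧ RSubset Y X

/-- The closure `H_α` of the sequence `α⁰, α¹, …` of real numbers. -/
def closureSeq (F : Set (ℕ → ℕ)) (α : ℕ → ℕ) : Set (ℕ → ℕ) :=
  {x | x ∈ Reals F ∧ ∀ n, ∃ m, Contains (x n) (row α m)}

/-- `H` is a closed-and-separable set of real numbers. -/
def ClosedAndSeparable (F H : Set (ℕ → ℕ)) : Prop :=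
  H ⊆ Reals F ∧ ∃ α ∈ F, (∀ n, IsReal (row α n)) ∧ RCoincide H (closureSeq F α)

/-- The set `B` of (codes of) segments covers `H`. -/
def Covers (B : Set ℕ) (H : Set (ℕ → ℕ)) : Prop :=
  ∀ x ∈ H, ∃ s ∈ B, Contains s x

def UpperBound (H : Set (ℕ → ℕ)) (y : ℕ → ℕ) : Prop := ∀ x ∈ H, RLe x y

def LowerBound (H : Set (ℕ → ℕ)) (y : ℕ → ℕ) : Prop := ∀ x ∈ H, RLe y x

def LeastUpperBound (F H : Set (ℕ → ℕ)) (y : ℕ → ℕ) : Prop :=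
  UpperBound H y ∧ ∀ z ∈ Reals F, RLt z y → ∃ x ∈ H, RLt z x

/-- `y` almost is a largest element of `H`. -/
def AlmostLargest (F H : Set (ℕ → ℕ)) (y : ℕ → ℕ) : Prop :=
  LeastUpperBound F H y ∧ ∀ z ∈ Reals F, (∀ x ∈ H, RLt x z) → RLt y z

def BoundedAbove (F H : Set (ℕ → ℕ)) : Prop := ∃ y ∈ Reals F, UpperBound H y

def BoundedBelow (F H : Set (ℕ → ℕ)) : Prop := ∃ y ∈ Reals F, LowerBound H y

def IsBdd (F H : Set (ℕ → ℕ)) : Prop := BoundedAbove F H ∧ BoundedBelow F H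

def HasLub (F H : Set (ℕ → ℕ)) : Prop := ∃ y ∈ Reals F, LeastUpperBound F H y

def AlmostHasMax (F H : Set (ℕ → ℕ)) : Prop := ∃ y ∈ Reals F, AlmostLargest F H y

def TotBdd (H : Set (ℕ → ℕ)) : Prop :=
  ∀ n : ℕ, ∃ B : Finset ℕ, Covers (↑B) H ∧
    ∀ s ∈ B, IsSeg s ∧ (∃ x ∈ H, Contains s x) ∧ segLength s ≤ 1 / 2 ^ n

/-! ### Continuous functions -/

/-- The set `X` of pairs of segments is a partial continuous function from `ℝ` to `ℝ`. -/
def PartialCont (X : Set ℕ) : Prop :=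
  (∀ n ∈ X, ∃ r s, IsSeg r ∧ IsSeg s ∧ n = Nat.pair r s) ∧
  (∀ r s t, IsSeg r → IsSeg s → IsSeg t → Nat.pair r s ∈ X → Included t r → Nat.pair t s ∈ X) ∧
  (∀ r s t, IsSeg r → IsSeg s → IsSeg t → Nat.pair r s ∈ X → Included s t → Nat.pair r t ∈ X) ∧
  (∀ r s t, IsSeg r → IsSeg s → IsSeg t → Nat.pair r s ∈ X → Nat.pair r t ∈ X → Touches s t)

/-- `X` maps `x` onto `y`. -/
def MapsOnto (X : Set ℕ) (x y : ℕ → ℕ) : Prop := ∀ n, ∃ m, Nat.pair (x m) (y n) ∈ X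

def dom (F : Set (ℕ → ℕ)) (X : Set ℕ) : Set (ℕ → ℕ) :=
  {x | x ∈ Reals F ∧ ∃ y ∈ Reals F, MapsOnto X x y}

def ran (F : Set (ℕ → ℕ)) (X : Set ℕ) : Set (ℕ → ℕ) :=
  {y | y ∈ Reals F ∧ ∃ x ∈ Reals F, MapsOnto X x y}

/-- `φ` enumerates a continuous function from `H` to `ℝ`. -/
def EnumCont (F H : Set (ℕ → ℕ)) (φ : ℕ → ℕ) : Prop :=
  PartialCont (enum φ) ∧ RCoincide H (dom F (enum φ))

/-- `y` is a value at `x` of the function enumerated by `φ` (any two such values really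
coincide). -/
def IsValue (F : Set (ℕ → ℕ)) (φ x y : ℕ → ℕ) : Prop := y ∈ Reals F ∧ MapsOnto (enum φ) x y

/-- The function enumerated by `φ` is uniformly continuous on `H`. -/
def UnifCont (F H : Set (ℕ → ℕ)) (φ : ℕ → ℕ) : Prop :=
  ∀ m : ℕ, ∃ n : ℕ, ∀ x ∈ H, ∀ x' ∈ H, ∀ y y', IsValue F φ x y → IsValue F φ x' y' →
    DistLt x x' (1 / 2 ^ n) → DistLt y y' (1 / 2 ^ m)

/-- The function enumerated by `φ` is positive on `H`. -/
def PosOn (F H : Set (ℕ → ℕ)) (φ : ℕ → ℕ) : Prop :=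
  ∀ x ∈ H, ∀ y, IsValue F φ x y → RatLt 0 y

/-- The function enumerated by `φ` is bounded away from `0` on `H`. -/
def PosBoundedAway (F H : Set (ℕ → ℕ)) (φ : ℕ → ℕ) : Prop :=
  ∃ m : ℕ, ∀ x ∈ H, ∀ y, IsValue F φ x y → RatLt (1 / 2 ^ m) y

/-! ### The properties to be compared -/

/-- Every enumerable covering of `H` has a finite subcovering. -/
def HeineBorel (F H : Set (ℕ → ℕ)) : Prop :=
  ∀ β ∈ F, Covers (enum β) H → ∃ n, Covers (enumUpTo β n) H

/-- Dini's property. -/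
def Dini (F H : Set (ℕ → ℕ)) : Prop :=
  ∀ φ ∈ F, (∀ n, EnumCont F H (row φ n)) →
    (∀ n, ∀ x ∈ H, ∀ y y', IsValue F (row φ n) x y → IsValue F (row φ (n + 1)) x y' →
      RLe y' y ∧ RatLe 0 y') →
    (∀ m : ℕ, ∀ x ∈ H, ∃ n, ∀ y, IsValue F (row φ n) x y → LeRat y (1 / 2 ^ m)) →
    ∀ m : ℕ, ∃ n, ∀ x ∈ H, ∀ y, IsValue F (row φ n) x y → LeRat y (1 / 2 ^ m)

end BIM

/-!
A real number of the universe `F` is read as a classical real number (`val`). Then `H` becomes the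
set of the `F`-reals in the closure of the sequence `αᵏ` (`IsClosureOf`), total boundedness becomes
boundedness (`totBdd_iff`), and "almost has a maximum" becomes "attains a maximum". Effectiveness
remains in two places only: the coverings and the functions have to be enumerated by elements
of `F`. It is handled by three predicates: `InF` (functions tracked by an element of `F`), `CompQ`
(rational values computed by an element of `F`) and `Sig` (projections of relations decided by an
element of `F`). The last are exactly the enumerable sets, and the closure of `F` under unbounded
search yields witnesses for them.

From the Heine–Borel property, everything else follows by one finite covering each, of segments
`r` such that the enumeration contains a pair `⟨r, s⟩` with a suitable semidecidable property. For
the maximum the property is that `s` lies below the value of the function at some `αᵏ`: if no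
maximum is attained, these `r` cover `H`, and then the largest of finitely many values at such `αᵏ`
is larger than every value of the function, itself included.

Conversely, suppose that `β` enumerates a covering of `H` without a finite subcovering. It carries
a computable partition of unity `weight β n`, locally finite at the covered points, such that at a
point outside the first `n` segments only the weights from the `n`-th on are positive. By
`exists_enumCont_blend_rows`, every computable sequence `c` of nonnegative rational numbers gives an
enumerable function `blend β c`, the average of the `c m` with these weights. Each of the other
properties is refuted by a choice of `c`: `m` is unbounded, `m / (m + 1)` has no maximum,
`1 / (m + 1)` is uniformly continuous and positive with infimum `0`, and the indicators of
`{m | j ≤ m}` violate Dini's property. For uniform continuity on a bounded `H`, a search finds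
pairs `αⁱ`, `αʲ` that are closer and closer together while their weights live on consecutive
blocks of stages; coefficients `0` and `1` on alternate blocks give a bounded function that
oscillates (`heineBorel_of_unifCont`).

To make a function enumerable with domain exactly `H`, `exists_enumCont` lets a pair `⟨r, s⟩` in
only if `r` is included in a segment not longer than `s` that contains some `αⁱ`.
-/

namespace BIM

/-! ### Functions tracked by the universe -/

section

open Encodable Finset

variable {F : Set (ℕ → ℕ)} {α β γ : Type*} [Primcodable α] [Primcodable β] [Primcodable γ]

theorem IsUniverse.mem_of_primrec (hF : IsUniverse F) {f : ℕ → ℕ} (hf : Nat.Primrec f) :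
    f ∈ F := by
  induction hf with
  | zero => exact hF.zero
  | succ => exact hF.succ
  | left => exact hF.left
  | right => exact hF.right
  | pair _ _ hf hg => exact hF.pair _ hf _ hg
  | comp _ _ hf hg => exact hF.comp _ hf _ hg
  | @prec f g _ _ hf hg =>
    -- `Nat.Primrec` feeds the step function `⟨z, ⟨y, IH⟩⟩`, the universe feeds it `⟨⟨z, y⟩, IH⟩`.
    have hr : (fun n : ℕ => Nat.pair n.unpair.1.unpair.1 (Nat.pair n.unpair.1.unpair.2 n.unpair.2))
        ∈ F :=
      hF.pair _ (hF.comp _ hF.left _ hF.left) _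
        (hF.pair _ (hF.comp _ hF.right _ hF.left) _ hF.right)
    obtain ⟨c, hc, h⟩ := hF.prec f hf _ (hF.comp g hg _ hr)
    convert hc using 1
    funext n
    obtain ⟨m, k, rfl⟩ : ∃ m k, n = Nat.pair m k := ⟨_, _, (Nat.pair_unpair n).symm⟩
    simp only [Nat.unpaired, Nat.unpair_pair]
    induction k with
    | zero => exact (h m 0).1.symm
    | succ k ih =>
      rw [(h m k).2]
      simp [ih]

/-- The function `f` between coded types is tracked by a function of `F` on the codes. -/
def InF (F : Set (ℕ → ℕ)) (f : α → β) : Prop := ∃ g ∈ F, ∀ a, g (encode a) = encode (f a)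

theorem InF.mem {f : ℕ → ℕ} (hf : InF F f) : f ∈ F := by
  obtain ⟨g, hg, h⟩ := hf
  convert hg using 1
  funext n
  simpa using (h n).symm

theorem InF.of_mem {f : ℕ → ℕ} (hf : f ∈ F) : InF F f := ⟨f, hf, fun _ => rfl⟩

theorem InF.of_primrec (hF : IsUniverse F) {f : α → β} (hf : Primrec f) : InF F f := by
  refine ⟨_, hF.comp _ (hF.mem_of_primrec Nat.Primrec.pred) _ (hF.mem_of_primrec hf), fun a => ?_⟩
  simp

theorem InF.comp (hF : IsUniverse F) {f : β → γ} {g : α → β} (hf : InF F f) (hg : InF F g) :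
    InF F (fun a => f (g a)) := by
  obtain ⟨f', hf', h⟩ := hf
  obtain ⟨g', hg', k⟩ := hg
  exact ⟨_, hF.comp _ hf' _ hg', fun a => by rw [k, h]⟩

theorem InF.prodMk (hF : IsUniverse F) {f : α → β} {g : α → γ} (hf : InF F f) (hg : InF F g) :
    InF F (fun a => (f a, g a)) := by
  obtain ⟨f', hf', h⟩ := hf
  obtain ⟨g', hg', k⟩ := hg
  exact ⟨_, hF.pair _ hf' _ hg', fun a => by rw [k, h, Encodable.encode_prod_val]⟩

theorem InF.fst (hF : IsUniverse F) {f : α → β × γ} (hf : InF F f) : InF F (fun a => (f a).1) :=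
  (InF.of_primrec hF Primrec.fst).comp hF hf

theorem InF.snd (hF : IsUniverse F) {f : α → β × γ} (hf : InF F f) : InF F (fun a => (f a).2) :=
  (InF.of_primrec hF Primrec.snd).comp hF hf

theorem InF.id (hF : IsUniverse F) : InF F (fun a : α => a) := InF.of_primrec hF Primrec.id

theorem InF.const (hF : IsUniverse F) (b : β) : InF F (fun _ : α => b) :=
  InF.of_primrec hF (Primrec.const b)

theorem InF.map₂ (hF : IsUniverse F) {op : ℕ → ℕ → ℕ} (hop : Primrec₂ op) {f g : α → ℕ}
    (hf : InF F f) (hg : InF F g) : InF F (fun a => op (f a) (g a)) :=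
  (InF.of_primrec hF hop).comp hF (hf.prodMk hF hg)

theorem InF.add (hF : IsUniverse F) {f g : α → ℕ} (hf : InF F f) (hg : InF F g) :
    InF F (fun a => f a + g a) := InF.map₂ hF Primrec.nat_add hf hg

theorem InF.mul (hF : IsUniverse F) {f g : α → ℕ} (hf : InF F f) (hg : InF F g) :
    InF F (fun a => f a * g a) := InF.map₂ hF Primrec.nat_mul hf hg

theorem InF.sub (hF : IsUniverse F) {f g : α → ℕ} (hf : InF F f) (hg : InF F g) :
    InF F (fun a => f a - g a) := InF.map₂ hF Primrec.nat_sub hf hg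

theorem InF.natPair (hF : IsUniverse F) {f g : α → ℕ} (hf : InF F f) (hg : InF F g) :
    InF F (fun a => Nat.pair (f a) (g a)) := InF.map₂ hF Primrec₂.natPair hf hg

theorem InF.unpair (hF : IsUniverse F) {f : α → ℕ} (hf : InF F f) :
    InF F (fun a => (f a).unpair) := (InF.of_primrec hF Primrec.unpair).comp hF hf

theorem InF.ite (hF : IsUniverse F) {c f g : α → ℕ} (hc : InF F c) (hf : InF F f)
    (hg : InF F g) : InF F (fun a => if c a = 0 then f a else g a) := by
  have h : Primrec fun p : ℕ × ℕ × ℕ => if p.1 = 0 then p.2.1 else p.2.2 :=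
    Primrec.ite (Primrec.eq.comp Primrec.fst (Primrec.const 0))
      (Primrec.fst.comp Primrec.snd) (Primrec.snd.comp Primrec.snd)
  exact (InF.of_primrec hF h).comp hF (hc.prodMk hF (hf.prodMk hF hg))

theorem InF.natRec (hF : IsUniverse F) {N f : α → ℕ} {g : α × ℕ × ℕ → ℕ} (hN : InF F N)
    (hf : InF F f) (hg : InF F g) :
    InF F (fun a => Nat.rec (motive := fun _ => ℕ) (f a) (fun n ih => g (a, n, ih)) (N a)) := by
  obtain ⟨N', hN', hN⟩ := hN
  obtain ⟨f', hf', hf⟩ := hf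
  obtain ⟨g', hg', hg⟩ := hg
  have hr : (fun n : ℕ => Nat.pair n.unpair.1.unpair.1 (Nat.pair n.unpair.1.unpair.2 n.unpair.2))
      ∈ F :=
    hF.pair _ (hF.comp _ hF.left _ hF.left) _
      (hF.pair _ (hF.comp _ hF.right _ hF.left) _ hF.right)
  obtain ⟨c, hc, h⟩ := hF.prec f' hf' _ (hF.comp g' hg' _ hr)
  have hid : (fun n : ℕ => n) ∈ F := hF.mem_of_primrec Nat.Primrec.id
  refine ⟨_, hF.comp c hc _ (hF.pair _ hid _ hN'), fun a => ?_⟩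
  simp only [hN, encode_nat]
  induction N a with
  | zero => rw [(h _ 0).1, hf]; rfl
  | succ k ih =>
    rw [(h _ k).2]
    simp only [Nat.unpair_pair]
    rw [ih]
    exact hg (a, k, _)

/-! ### Computable rational values -/

/-- The values of `f` are rational and have codes computed by a function of `F`. -/
def CompQ (F : Set (ℕ → ℕ)) (f : α → ℝ) : Prop :=
  ∃ g : α → ℕ, InF F g ∧ ∀ a, f a = (ratOf (g a) : ℝ)

theorem CompQ.comp (hF : IsUniverse F) {f : β → ℝ} {g : α → β} (hf : CompQ F f)
    (hg : InF F g) : CompQ F (fun a => f (g a)) := by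
  obtain ⟨f', hf', h⟩ := hf
  exact ⟨_, hf'.comp hF hg, fun a => h _⟩

theorem CompQ.ratOf {g : α → ℕ} (hg : InF F g) :
    CompQ F (fun a => (BIM.ratOf (g a) : ℝ)) := ⟨g, hg, fun _ => rfl⟩

theorem CompQ.lo (hF : IsUniverse F) {g : α → ℕ} (hg : InF F g) :
    CompQ F (fun a => (BIM.lo (g a) : ℝ)) := CompQ.ratOf ((hg.unpair hF).fst hF)

theorem CompQ.hi (hF : IsUniverse F) {g : α → ℕ} (hg : InF F g) :
    CompQ F (fun a => (BIM.hi (g a) : ℝ)) := CompQ.ratOf ((hg.unpair hF).snd hF)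

/-- The code of the fraction `(a - b) / (d + 1)`. -/
def mkRat (a b d : ℕ) : ℕ := Nat.pair (Nat.pair a b) d

theorem ratOf_mkRat (a b d : ℕ) : ratOf (mkRat a b d) = ((a : ℚ) - b) / (d + 1) := by
  simp [ratOf, mkRat]

theorem exists_ratOf (q : ℚ) : ∃ c, ratOf c = q := by
  refine ⟨mkRat q.num.toNat (-q.num).toNat (q.den - 1), ?_⟩
  rw [ratOf_mkRat]
  have h1 : ((q.num.toNat : ℚ) - ((-q.num).toNat : ℚ)) = q.num := by
    have : (q.num.toNat : ℤ) - ((-q.num).toNat : ℤ) = q.num := by omega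
    exact_mod_cast this
  have h2 : ((q.den - 1 : ℕ) : ℚ) + 1 = q.den := by
    have := q.den_pos
    have h : (q.den - 1) + 1 = q.den := by omega
    exact_mod_cast h
  rw [h1, h2, Rat.num_div_den]

theorem CompQ.mkRat (hF : IsUniverse F) {f g h : α → ℕ} (hf : InF F f) (hg : InF F g)
    (hh : InF F h) : CompQ F (fun a => ((f a : ℝ) - g a) / (h a + 1)) :=
  ⟨_, (hf.natPair hF hg).natPair hF hh, fun a => by
    have := congrArg (fun q : ℚ => (q : ℝ)) (ratOf_mkRat (f a) (g a) (h a))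
    push_cast at this
    exact this.symm⟩

/-- The value of a computable rational function as a fraction of computable natural numbers. -/
theorem CompQ.exists_frac (hF : IsUniverse F) {f : α → ℝ} (hf : CompQ F f) :
    ∃ a b d : α → ℕ, InF F a ∧ InF F b ∧ InF F d ∧
      ∀ x, f x = ((a x : ℝ) - b x) / (d x + 1) := by
  obtain ⟨g, hg, h⟩ := hf
  have hu := hg.unpair hF
  refine ⟨_, _, _, (((hu.fst hF).unpair hF).fst hF), (((hu.fst hF).unpair hF).snd hF),
    (hu.snd hF), fun x => ?_⟩
  rw [h, BIM.ratOf]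
  push_cast
  rfl

theorem CompQ.natCast (hF : IsUniverse F) {f : α → ℕ} (hf : InF F f) :
    CompQ F (fun a => (f a : ℝ)) := by
  simpa using CompQ.mkRat hF hf (InF.const hF 0) (InF.const hF 0)

theorem CompQ.const (hF : IsUniverse F) (q : ℚ) : CompQ F (fun _ : α => (q : ℝ)) := by
  obtain ⟨c, rfl⟩ := exists_ratOf q
  exact CompQ.ratOf (InF.const hF c)

theorem CompQ.add (hF : IsUniverse F) {f g : α → ℝ} (hf : CompQ F f) (hg : CompQ F g) :
    CompQ F (fun a => f a + g a) := by
  obtain ⟨a, b, d, ha, hb, hd, h⟩ := hf.exists_frac hF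
  obtain ⟨a', b', d', ha', hb', hd', h'⟩ := hg.exists_frac hF
  have one : InF F (fun _ : α => 1) := InF.const hF 1
  have key := CompQ.mkRat hF
    ((ha.mul hF (hd'.add hF one)).add hF (ha'.mul hF (hd.add hF one)))
    ((hb.mul hF (hd'.add hF one)).add hF (hb'.mul hF (hd.add hF one)))
    (((hd.mul hF hd').add hF hd).add hF hd')
  convert key using 2 with x
  rw [h, h']
  push_cast
  have h1 : (d x : ℝ) + 1 ≠ 0 := by positivity
  have h2 : (d' x : ℝ) + 1 ≠ 0 := by positivity
  have h3 : (d x : ℝ) * d' x + d x + d' x + 1 ≠ 0 := by positivity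
  field_simp
  ring

theorem CompQ.mul (hF : IsUniverse F) {f g : α → ℝ} (hf : CompQ F f) (hg : CompQ F g) :
    CompQ F (fun a => f a * g a) := by
  obtain ⟨a, b, d, ha, hb, hd, h⟩ := hf.exists_frac hF
  obtain ⟨a', b', d', ha', hb', hd', h'⟩ := hg.exists_frac hF
  have key := CompQ.mkRat hF
    ((ha.mul hF ha').add hF (hb.mul hF hb')) ((ha.mul hF hb').add hF (hb.mul hF ha'))
    (((hd.mul hF hd').add hF hd).add hF hd')
  convert key using 2 with x
  rw [h, h']
  push_cast
  have h1 : (d x : ℝ) + 1 ≠ 0 := by positivity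
  have h2 : (d' x : ℝ) + 1 ≠ 0 := by positivity
  have h3 : (d x : ℝ) * d' x + d x + d' x + 1 ≠ 0 := by positivity
  field_simp
  ring

theorem CompQ.neg (hF : IsUniverse F) {f : α → ℝ} (hf : CompQ F f) :
    CompQ F (fun a => -f a) := by
  simpa using (CompQ.const hF (-1)).mul hF hf

theorem CompQ.sub (hF : IsUniverse F) {f g : α → ℝ} (hf : CompQ F f) (hg : CompQ F g) :
    CompQ F (fun a => f a - g a) := by
  simpa [sub_eq_add_neg] using hf.add hF (hg.neg hF)

theorem CompQ.exists_le (hF : IsUniverse F) {f g : α → ℝ} (hf : CompQ F f) (hg : CompQ F g) :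
    ∃ c : α → ℕ, InF F c ∧ ∀ a, f a ≤ g a ↔ c a = 0 := by
  obtain ⟨a, b, d, ha, hb, hd, h⟩ := (hf.sub hF hg).exists_frac hF
  refine ⟨_, ha.sub hF hb, fun x => ?_⟩
  have h1 : (0 : ℝ) < d x + 1 := by positivity
  rw [← sub_nonpos, h, div_le_iff₀ h1, zero_mul, sub_nonpos, Nat.cast_le, Nat.sub_eq_zero_iff_le]

theorem CompQ.exists_lt (hF : IsUniverse F) {f g : α → ℝ} (hf : CompQ F f) (hg : CompQ F g) :
    ∃ c : α → ℕ, InF F c ∧ ∀ a, f a < g a ↔ c a = 0 := by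
  obtain ⟨a, b, d, ha, hb, hd, h⟩ := (hf.sub hF hg).exists_frac hF
  refine ⟨_, (ha.add hF (InF.const hF 1)).sub hF hb, fun x => ?_⟩
  have h1 : (0 : ℝ) < d x + 1 := by positivity
  rw [← sub_neg, h, div_lt_iff₀ h1, zero_mul, sub_neg, Nat.cast_lt, Nat.sub_eq_zero_iff_le]
  rfl

theorem CompQ.max (hF : IsUniverse F) {f g : α → ℝ} (hf : CompQ F f) (hg : CompQ F g) :
    CompQ F (fun a => max (f a) (g a)) := by
  obtain ⟨c, hc, h⟩ := hf.exists_le hF hg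
  obtain ⟨f', hf', hf⟩ := hf
  obtain ⟨g', hg', hg⟩ := hg
  refine ⟨_, hc.ite hF hg' hf', fun a => ?_⟩
  beta_reduce
  by_cases h0 : c a = 0
  · rw [max_eq_right ((h a).2 h0), hg, if_pos h0]
  · rw [max_eq_left (not_le.1 (mt (h a).1 h0)).le, hf, if_neg h0]

theorem CompQ.min (hF : IsUniverse F) {f g : α → ℝ} (hf : CompQ F f) (hg : CompQ F g) :
    CompQ F (fun a => min (f a) (g a)) := by
  simpa [max_neg_neg] using ((hf.neg hF).max hF (hg.neg hF)).neg hF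

theorem CompQ.sum (hF : IsUniverse F) {f : α × ℕ → ℝ} {N : α → ℕ} (hf : CompQ F f)
    (hN : InF F N) : CompQ F (fun a => ∑ m ∈ range (N a), f (a, m)) := by
  -- The running total is one of the arguments of the step function, on codes.
  have hin : InF F (fun p : α × ℕ × ℕ => (p.1, p.2.1)) :=
    InF.of_primrec hF (Primrec.fst.pair (Primrec.fst.comp Primrec.snd))
  have hlast : InF F (fun p : α × ℕ × ℕ => p.2.2) :=
    InF.of_primrec hF (Primrec.snd.comp Primrec.snd)
  obtain ⟨g, hg, h⟩ := (CompQ.ratOf hlast).add hF (hf.comp hF hin)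
  refine ⟨_, InF.natRec hF hN (InF.const hF 0) hg, fun a => ?_⟩
  beta_reduce
  induction N a with
  | zero => simp [BIM.ratOf]
  | succ n ih =>
    rw [sum_range_succ, ih]
    exact h (a, n, _)

theorem CompQ.twoPow (hF : IsUniverse F) {f : α → ℕ} (hf : InF F f) :
    CompQ F (fun a => 1 / (2 : ℝ) ^ f a) := by
  have h : Primrec fun n : ℕ => Nat.rec (motive := fun _ => ℕ) 1 (fun _ ih => ih * 2) n :=
    Primrec.nat_rec₁ 1 (Primrec.nat_mul.comp Primrec.snd (Primrec.const 2))
  have key := CompQ.mkRat hF (InF.const hF 1) (InF.const hF 0)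
    (((InF.of_primrec hF h).comp hF hf).sub hF (InF.const hF 1))
  convert key using 2 with a
  have h2 : ∀ n : ℕ, Nat.rec (motive := fun _ => ℕ) 1 (fun _ ih => ih * 2) n = 2 ^ n := by
    intro n
    induction n with
    | zero => rfl
    | succ n ih => rw [pow_succ, ← ih]
  simp only [h2]
  rw [Nat.cast_sub Nat.one_le_two_pow]
  simp

/-! ### Semidecidable relations -/

/-- The predicate `p` is the projection of a predicate decided by a function of `F`. -/
def Sig (F : Set (ℕ → ℕ)) (p : α → Prop) : Prop :=
  ∃ c : α × ℕ → ℕ, InF F c ∧ ∀ a, p a ↔ ∃ n, c (a, n) = 0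

theorem Sig.of_eq_zero (hF : IsUniverse F) {c : α → ℕ} (hc : InF F c) :
    Sig F (fun a => c a = 0) :=
  ⟨fun p => c p.1, hc.comp hF ((InF.id hF).fst hF), fun a => by simp⟩

theorem Sig.congr {p q : α → Prop} (hp : Sig F p) (h : ∀ a, q a ↔ p a) : Sig F q := by
  rwa [show q = p from funext fun a => propext (h a)]

theorem Sig.comp (hF : IsUniverse F) {p : β → Prop} {g : α → β} (hp : Sig F p)
    (hg : InF F g) : Sig F (fun a => p (g a)) := by
  obtain ⟨c, hc, h⟩ := hp
  exact ⟨fun x => c (g x.1, x.2),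
    hc.comp hF ((hg.comp hF ((InF.id hF).fst hF)).prodMk hF ((InF.id hF).snd hF)), fun a => h _⟩

theorem Sig.and (hF : IsUniverse F) {p q : α → Prop} (hp : Sig F p) (hq : Sig F q) :
    Sig F (fun a => p a ∧ q a) := by
  obtain ⟨c, hc, h⟩ := hp
  obtain ⟨d, hd, k⟩ := hq
  have hu := ((InF.id (α := α × ℕ) hF).snd hF).unpair hF
  have h1 := (InF.id (α := α × ℕ) hF).fst hF
  refine ⟨_, (hc.comp hF (h1.prodMk hF (hu.fst hF))).add hF
    (hd.comp hF (h1.prodMk hF (hu.snd hF))), fun a => ?_⟩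
  beta_reduce
  rw [h, k]
  constructor
  · rintro ⟨⟨m, hm⟩, n, hn⟩
    exact ⟨Nat.pair m n, by simp [hm, hn]⟩
  · rintro ⟨m, hm⟩
    obtain ⟨h1, h2⟩ := Nat.add_eq_zero_iff.1 hm
    exact ⟨⟨_, h1⟩, _, h2⟩

theorem Sig.exists (hF : IsUniverse F) {p : α × ℕ → Prop} (hp : Sig F p) :
    Sig F (fun a => ∃ n, p (a, n)) := by
  obtain ⟨c, hc, h⟩ := hp
  have hu := ((InF.id (α := α × ℕ) hF).snd hF).unpair hF
  have h1 := (InF.id (α := α × ℕ) hF).fst hF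
  refine ⟨_, hc.comp hF ((h1.prodMk hF (hu.fst hF)).prodMk hF (hu.snd hF)), fun a => ?_⟩
  simp only [h]
  constructor
  · rintro ⟨m, n, hn⟩
    exact ⟨Nat.pair m n, by simpa using hn⟩
  · rintro ⟨m, hm⟩
    exact ⟨_, _, hm⟩

theorem CompQ.sig_le (hF : IsUniverse F) {f g : α → ℝ} (hf : CompQ F f) (hg : CompQ F g) :
    Sig F (fun a => f a ≤ g a) := by
  obtain ⟨c, hc, h⟩ := hf.exists_le hF hg
  exact (Sig.of_eq_zero hF hc).congr h

theorem CompQ.sig_lt (hF : IsUniverse F) {f g : α → ℝ} (hf : CompQ F f) (hg : CompQ F g) :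
    Sig F (fun a => f a < g a) := by
  obtain ⟨c, hc, h⟩ := hf.exists_lt hF hg
  exact (Sig.of_eq_zero hF hc).congr h

theorem Sig.le (hF : IsUniverse F) {f g : α → ℕ} (hf : InF F f) (hg : InF F g) :
    Sig F (fun a => f a ≤ g a) :=
  (Sig.of_eq_zero hF (hf.sub hF hg)).congr fun _ => Nat.sub_eq_zero_iff_le.symm

theorem Sig.eq (hF : IsUniverse F) {f g : α → ℕ} (hf : InF F f) (hg : InF F g) :
    Sig F (fun a => f a = g a) :=
  ((Sig.le hF hf hg).and hF (Sig.le hF hg hf)).congr fun _ => le_antisymm_iff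

/-- Unbounded search for witnesses of a semidecidable relation. -/
theorem Sig.search (hF : IsUniverse F) {p : ℕ × ℕ → Prop} (hp : Sig F p)
    (h : ∀ m, ∃ n, p (m, n)) : ∃ f ∈ F, ∀ m, p (m, f m) := by
  obtain ⟨c, hc, hcp⟩ := hp
  have hu := (InF.id (α := ℕ) hF).unpair hF
  have hm := hc.comp hF (((hu.fst hF).prodMk hF (((hu.snd hF).unpair hF).fst hF)).prodMk hF
    (((hu.snd hF).unpair hF).snd hF))
  obtain ⟨f, hf, hs⟩ := hF.search _ hm.mem fun m => by
    obtain ⟨n, hn⟩ := h m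
    obtain ⟨k, hk⟩ := (hcp _).1 hn
    exact ⟨Nat.pair n k, by simpa using hk⟩
  refine ⟨_, hF.comp _ hF.left _ hf, fun m => (hcp _).2 ⟨((f m).unpair).2, ?_⟩⟩
  simpa using hs m

/-- A semidecidable relation is enumerated, section by section, by the rows of a function
of `F`. -/
theorem Sig.exists_rows (hF : IsUniverse F) {p : ℕ × ℕ → Prop} (hp : Sig F p) :
    ∃ φ ∈ F, ∀ j, enum (row φ j) = {k | p (j, k)} := by
  obtain ⟨c, hc, h⟩ := hp
  have hu := (InF.id (α := ℕ) hF).unpair hF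
  have hk := ((hu.snd hF).unpair hF).fst hF
  have key := (hc.comp hF (((hu.fst hF).prodMk hF hk).prodMk hF
    (((hu.snd hF).unpair hF).snd hF))).ite hF (hk.add hF (InF.const hF 1)) (InF.const hF 0)
  refine ⟨_, key.mem, fun j => ?_⟩
  ext k
  simp only [enum, row, Set.mem_ofPred_eq, Nat.unpair_pair, h]
  constructor
  · rintro ⟨m, hm⟩
    split_ifs at hm with h0
    exact ⟨m.unpair.2, by rwa [← Nat.succ.inj hm]⟩
  · rintro ⟨n, hn⟩
    exact ⟨Nat.pair k n, by simp [hn]⟩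

theorem Sig.exists_enum (hF : IsUniverse F) {p : ℕ → Prop} (hp : Sig F p) :
    ∃ φ ∈ F, enum φ = {k | p k} := by
  obtain ⟨φ, hφ, h⟩ := Sig.exists_rows hF (hp.comp hF ((InF.id (α := ℕ × ℕ) hF).snd hF))
  exact ⟨row φ 0, hF.comp _ hφ _ (hF.pair _ hF.zero _ (InF.id (α := ℕ) hF).mem), h 0⟩

theorem Sig.mem_enum_row (hF : IsUniverse F) {φ : ℕ → ℕ} (hφ : φ ∈ F) {j k : α → ℕ}
    (hj : InF F j) (hk : InF F k) : Sig F (fun a => k a ∈ enum (row φ (j a))) := by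
  have h1 := (InF.id (α := α × ℕ) hF).fst hF
  have h2 := (InF.id (α := α × ℕ) hF).snd hF
  exact Sig.exists hF (Sig.eq hF
    ((InF.of_mem hφ).comp hF ((hj.comp hF h1).natPair hF h2))
    ((hk.comp hF h1).add hF (InF.const hF 1)))

theorem Sig.mem_enum (hF : IsUniverse F) {φ : ℕ → ℕ} (hφ : φ ∈ F) {k : α → ℕ}
    (hk : InF F k) : Sig F (fun a => k a ∈ enum φ) := by
  have h1 := (InF.id (α := α × ℕ) hF).fst hF
  have h2 := (InF.id (α := α × ℕ) hF).snd hF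
  exact Sig.exists hF (Sig.eq hF ((InF.of_mem hφ).comp hF h2)
    ((hk.comp hF h1).add hF (InF.const hF 1)))

end

section

open Encodable Finset

variable {F : Set (ℕ → ℕ)} {H : Set (ℕ → ℕ)} {x y : ℕ → ℕ}

/-! ### Real numbers of the universe as real numbers -/

/-- The classical real number given by a dwindling sequence of segments. -/
noncomputable def val (x : ℕ → ℕ) : ℝ := ⨆ n, (lo (x n) : ℝ)

theorem IsReal.lo_strictMono (hx : IsReal x) : StrictMono fun n => lo (x n) :=
  strictMono_nat_of_lt_succ fun n => (hx.2.1 n).1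

theorem IsReal.hi_strictAnti (hx : IsReal x) : StrictAnti fun n => hi (x n) :=
  strictAnti_nat_of_succ_lt fun n => (hx.2.1 n).2

theorem IsReal.lo_le_hi (hx : IsReal x) (m n : ℕ) : lo (x m) ≤ hi (x n) :=
  (hx.lo_strictMono.monotone (le_max_left m n)).trans
    ((hx.1 _).trans (hx.hi_strictAnti.antitone (le_max_right m n)))

theorem IsReal.lo_lt_val (hx : IsReal x) (n : ℕ) : (lo (x n) : ℝ) < val x := by
  have hb : BddAbove (Set.range fun n => (lo (x n) : ℝ)) :=
    ⟨hi (x 0), by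
      rintro _ ⟨m, rfl⟩
      exact Rat.cast_le.2 (hx.lo_le_hi m 0)⟩
  have h1 : (lo (x n) : ℝ) < lo (x (n + 1)) := by exact_mod_cast (hx.2.1 n).1
  exact h1.trans_le (le_ciSup hb (n + 1))

theorem IsReal.val_lt_hi (hx : IsReal x) (n : ℕ) : val x < hi (x n) := by
  have h1 : (hi (x (n + 1)) : ℝ) < hi (x n) := by exact_mod_cast (hx.2.1 n).2
  exact (ciSup_le fun m => by exact_mod_cast hx.lo_le_hi m (n + 1)).trans_lt h1

theorem exists_one_div_two_pow_lt {ε : ℝ} (hε : 0 < ε) : ∃ n : ℕ, 1 / (2 : ℝ) ^ n < ε := by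
  obtain ⟨n, hn⟩ := exists_pow_lt_of_lt_one hε (by norm_num : (1 / 2 : ℝ) < 1)
  exact ⟨n, by simpa using hn⟩

theorem IsReal.eventually (hx : IsReal x) {a b : ℝ} (ha : a < val x) (hb : val x < b) :
    ∃ N, ∀ n ≥ N, a < lo (x n) ∧ (hi (x n) : ℝ) < b := by
  obtain ⟨k, hk⟩ := exists_one_div_two_pow_lt (lt_min (sub_pos.2 ha) (sub_pos.2 hb))
  obtain ⟨p, hp⟩ := hx.2.2 k
  have hp' : (hi (x p) : ℝ) - lo (x p) ≤ 1 / 2 ^ k := by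
    have : ((segLength (x p) : ℚ) : ℝ) ≤ ((1 / 2 ^ k : ℚ) : ℝ) := by exact_mod_cast hp
    simpa [segLength] using this
  have h1 := hx.lo_lt_val p
  have h2 := hx.val_lt_hi p
  obtain ⟨h3, h4⟩ := lt_min_iff.1 hk
  refine ⟨p, fun n hn => ?_⟩
  have h5 : (lo (x p) : ℝ) ≤ lo (x n) := by exact_mod_cast hx.lo_strictMono.monotone hn
  have h6 : (hi (x n) : ℝ) ≤ hi (x p) := by exact_mod_cast hx.hi_strictAnti.antitone hn
  constructor <;> linarith

theorem contains_iff (hx : IsReal x) (s : ℕ) :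
    Contains s x ↔ (lo s : ℝ) < val x ∧ val x < hi s := by
  constructor
  · rintro ⟨n, h1, h2⟩
    exact ⟨lt_trans (by exact_mod_cast h1) (hx.lo_lt_val n),
      (hx.val_lt_hi n).trans (by exact_mod_cast h2)⟩
  · rintro ⟨h1, h2⟩
    obtain ⟨N, h⟩ := hx.eventually h1 h2
    exact ⟨N, by exact_mod_cast (h N le_rfl).1, by exact_mod_cast (h N le_rfl).2⟩

theorem contains_self (hx : IsReal x) (n : ℕ) : Contains (x n) x :=
  (contains_iff hx _).2 ⟨hx.lo_lt_val n, hx.val_lt_hi n⟩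

theorem rlt_iff (hx : IsReal x) (hy : IsReal y) : RLt x y ↔ val x < val y := by
  constructor
  · rintro ⟨n, h⟩
    exact (hx.val_lt_hi n).trans ((Rat.cast_lt.2 h).trans (hy.lo_lt_val n))
  · intro h
    obtain ⟨N, h1⟩ := hx.eventually (sub_one_lt _) (left_lt_add_div_two.2 h)
    obtain ⟨M, h2⟩ := hy.eventually (add_div_two_lt_right.2 h) (lt_add_one _)
    exact ⟨max N M, by
      exact_mod_cast (h1 _ (le_max_left N M)).2.trans (h2 _ (le_max_right N M)).1⟩

theorem rle_iff (hx : IsReal x) (hy : IsReal y) : RLe x y ↔ val x ≤ val y := by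
  rw [← not_lt, ← rlt_iff hy hx]
  simp [RLe, RLt]

theorem req_iff (hx : IsReal x) (hy : IsReal y) : REq x y ↔ val x = val y := by
  rw [REq, rle_iff hx hy, rle_iff hy hx, le_antisymm_iff]

theorem ratLt_iff (hx : IsReal x) (q : ℚ) : RatLt q x ↔ (q : ℝ) < val x := by
  constructor
  · rintro ⟨n, h⟩
    exact (Rat.cast_lt.2 h).trans (hx.lo_lt_val n)
  · intro h
    obtain ⟨N, h1⟩ := hx.eventually h (lt_add_one _)
    exact ⟨N, by exact_mod_cast (h1 N le_rfl).1⟩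

theorem leRat_iff (hx : IsReal x) (q : ℚ) : LeRat x q ↔ val x ≤ (q : ℝ) := by
  rw [← not_lt, ← ratLt_iff hx]
  simp [LeRat, RatLt]

theorem ratLe_iff (hx : IsReal x) (q : ℚ) : RatLe q x ↔ (q : ℝ) ≤ val x := by
  constructor
  · intro h
    by_contra! hlt
    obtain ⟨N, h1⟩ := hx.eventually (sub_one_lt _) hlt
    exact absurd (Rat.cast_le.2 (h N)) (not_le.2 (h1 N le_rfl).2)
  · intro h n
    exact_mod_cast h.trans (hx.val_lt_hi n).le

theorem distLt_iff (hx : IsReal x) (hy : IsReal y) (q : ℚ) :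
    DistLt x y q ↔ |val x - val y| < q := by
  rw [abs_lt]
  constructor
  · rintro ⟨n, h1, h2⟩
    have h1' : (hi (x n) : ℝ) - lo (y n) < q := by exact_mod_cast h1
    have h2' : (hi (y n) : ℝ) - lo (x n) < q := by exact_mod_cast h2
    have := hx.lo_lt_val n
    have := hx.val_lt_hi n
    have := hy.lo_lt_val n
    have := hy.val_lt_hi n
    constructor <;> linarith
  · rintro ⟨h1, h2⟩
    obtain ⟨ε, hε, h3, h4⟩ : ∃ ε : ℝ, 0 < ε ∧ val x - val y + 2 * ε ≤ q ∧
        val y - val x + 2 * ε ≤ q := by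
      refine ⟨min (q - (val x - val y)) (q - (val y - val x)) / 2, ?_, ?_, ?_⟩
      · exact half_pos (lt_min (by linarith) (by linarith))
      · linarith [min_le_left ((q : ℝ) - (val x - val y)) (q - (val y - val x))]
      · linarith [min_le_right ((q : ℝ) - (val x - val y)) (q - (val y - val x))]
    obtain ⟨N, hN⟩ := hx.eventually (sub_lt_self _ hε) (lt_add_of_pos_right _ hε)
    obtain ⟨M, hM⟩ := hy.eventually (sub_lt_self _ hε) (lt_add_of_pos_right _ hε)
    have hN := hN _ (le_max_left N M)
    have hM := hM _ (le_max_right N M)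
    refine ⟨max N M, ?_, ?_⟩
    · have : (hi (x (max N M)) : ℝ) - lo (y (max N M)) < q := by linarith
      exact_mod_cast this
    · have : (hi (y (max N M)) : ℝ) - lo (x (max N M)) < q := by linarith
      exact_mod_cast this

theorem exists_segment (p q : ℚ) : ∃ s, lo s = p ∧ hi s = q := by
  obtain ⟨a, rfl⟩ := exists_ratOf p
  obtain ⟨b, rfl⟩ := exists_ratOf q
  exact ⟨Nat.pair a b, by simp [lo], by simp [hi]⟩

theorem exists_isSeg_between {a v b : ℝ} (ha : a < v) (hb : v < b) :
    ∃ s, IsSeg s ∧ a < lo s ∧ (lo s : ℝ) < v ∧ v < hi s ∧ (hi s : ℝ) < b := by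
  obtain ⟨p, hp1, hp2⟩ := exists_rat_btwn ha
  obtain ⟨q, hq1, hq2⟩ := exists_rat_btwn hb
  obtain ⟨s, rfl, rfl⟩ := exists_segment p q
  exact ⟨s, by exact_mod_cast (hp2.trans hq1).le, hp1, hp2, hq1, hq2⟩

/-- A number that has computable rational approximations belongs to the universe. -/
theorem exists_real_of_approx (hF : IsUniverse F) {a : ℕ → ℝ} (ha : CompQ F a) {v : ℝ}
    (h : ∀ n, |a n - v| ≤ 1 / 2 ^ n / 8) : ∃ y ∈ Reals F, val y = v := by
  have h2 : CompQ F fun n : ℕ => 1 / (2 : ℝ) ^ n := CompQ.twoPow hF (InF.id hF)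
  obtain ⟨l, hl, hl'⟩ := ha.sub hF h2
  obtain ⟨r, hr, hr'⟩ := ha.add hF h2
  have hlo : ∀ n, ((lo (Nat.pair (l n) (r n)) : ℚ) : ℝ) = a n - 1 / 2 ^ n := fun n => by
    simpa [lo] using (hl' n).symm
  have hhi : ∀ n, ((hi (Nat.pair (l n) (r n)) : ℚ) : ℝ) = a n + 1 / 2 ^ n := fun n => by
    simpa [hi] using (hr' n).symm
  have hpos : ∀ n : ℕ, 0 < 1 / (2 : ℝ) ^ n := fun n => by positivity
  have hhalf : ∀ n : ℕ, 1 / (2 : ℝ) ^ (n + 1) = 1 / 2 ^ n / 2 := fun n => by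
    rw [pow_succ, div_div]
  have hy : IsReal fun n => Nat.pair (l n) (r n) := by
    refine ⟨fun n => ?_, fun n => ?_, fun n => ⟨n + 1, ?_⟩⟩
    · have : ((lo (Nat.pair (l n) (r n)) : ℚ) : ℝ) ≤ (hi (Nat.pair (l n) (r n)) : ℚ) := by
        rw [hlo, hhi]
        linarith [hpos n]
      exact_mod_cast this
    · have e1 := abs_le.1 (h n)
      have e2 := abs_le.1 (h (n + 1))
      rw [hhalf] at e2
      have e3 := hpos n
      constructor
      · rw [← Rat.cast_lt (K := ℝ), hlo, hlo, hhalf]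
        linarith
      · rw [← Rat.cast_lt (K := ℝ), hhi, hhi, hhalf]
        linarith
    · have : ((segLength (Nat.pair (l (n + 1)) (r (n + 1))) : ℚ) : ℝ) ≤ ((1 / 2 ^ n : ℚ) : ℝ) := by
        rw [segLength, Rat.cast_sub, hlo, hhi, hhalf]
        push_cast
        linarith
      exact_mod_cast this
  refine ⟨_, ⟨(hl.natPair hF hr).mem, hy⟩, ?_⟩
  by_contra hne
  -- A gap between the value and `v` would be wider than some segment of the sequence.
  obtain ⟨n, hn⟩ := exists_one_div_two_pow_lt (half_pos (abs_pos.2 (sub_ne_zero.2 hne)))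
  have e1 := hy.lo_lt_val n
  have e2 := hy.val_lt_hi n
  simp only [hlo, hhi] at e1 e2
  have e3 := abs_le.1 (h n)
  have e4 := hpos n
  have : |val (fun n => Nat.pair (l n) (r n)) - v| ≤ 2 * (1 / 2 ^ n) := by
    rw [abs_le]
    constructor <;> linarith
  linarith

theorem exists_real_rat (hF : IsUniverse F) (q : ℚ) : ∃ y ∈ Reals F, val y = q :=
  exists_real_of_approx hF (CompQ.const hF q) fun n => by
    rw [sub_self, abs_zero]
    positivity

theorem totBdd_iff {H : Set (ℕ → ℕ)} (hH : H ⊆ Reals F) :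
    TotBdd H ↔ ∃ M : ℝ, ∀ x ∈ H, |val x| ≤ M := by
  constructor
  · intro h
    obtain ⟨B, hB, -⟩ := h 0
    refine ⟨∑ s ∈ B, (|(lo s : ℝ)| + |(hi s : ℝ)|), fun x hx => ?_⟩
    obtain ⟨s, hs, hsx⟩ := hB x hx
    obtain ⟨h1, h2⟩ := (contains_iff (hH hx).2 s).1 hsx
    refine le_trans ?_ (single_le_sum (f := fun s => |(lo s : ℝ)| + |(hi s : ℝ)|)
      (fun _ _ => by positivity) hs)
    have := neg_abs_le (lo s : ℝ)
    have := le_abs_self (hi s : ℝ)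
    have := abs_nonneg (lo s : ℝ)
    have := abs_nonneg (hi s : ℝ)
    rw [abs_le]
    constructor <;> linarith
  · rintro ⟨M, hM⟩ n
    classical
    choose g hg1 hg2 using fun i : ℤ =>
      exists_segment ((i : ℚ) / 2 ^ (n + 1)) (((i : ℚ) + 2) / 2 ^ (n + 1))
    have hN : (0 : ℝ) < 2 ^ (n + 1) := by positivity
    refine ⟨((Icc ⌊-M * 2 ^ (n + 1) - 2⌋ ⌈M * 2 ^ (n + 1)⌉).image g).filter
      fun s => ∃ x ∈ H, Contains s x, fun x hx => ?_, fun s hs => ?_⟩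
    · -- The grid segments overlap by a half, so one of them has the point in its interior.
      obtain ⟨i, hi'⟩ : ∃ i : ℤ, i = ⌈val x * 2 ^ (n + 1)⌉ - 1 := ⟨_, rfl⟩
      have e1 := Int.le_ceil (val x * 2 ^ (n + 1))
      have e2 := Int.ceil_lt_add_one (val x * 2 ^ (n + 1))
      have e3 : ((⌈val x * 2 ^ (n + 1)⌉ : ℤ) : ℝ) = i + 1 := by rw [hi']; push_cast; ring
      rw [e3] at e1 e2
      have hc : Contains (g i) x := by
        rw [contains_iff (hH hx).2, hg1, hg2]
        push_cast
        rw [div_lt_iff₀ hN, lt_div_iff₀ hN]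
        constructor <;> linarith
      have e4 := abs_le.1 (hM x hx)
      have e5 := mul_le_mul_of_nonneg_right e4.1 hN.le
      have e6 := mul_le_mul_of_nonneg_right e4.2 hN.le
      refine ⟨g i, ?_, hc⟩
      simp only [coe_filter, mem_image, mem_Icc, Set.mem_ofPred_eq]
      refine ⟨⟨i, ⟨?_, ?_⟩, rfl⟩, x, hx, hc⟩
      · have e7 := Int.floor_le (-M * 2 ^ (n + 1) - 2)
        have : ((⌊-M * 2 ^ (n + 1) - 2⌋ : ℤ) : ℝ) ≤ i := by linarith
        exact_mod_cast this
      · have e7 := Int.le_ceil (M * 2 ^ (n + 1))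
        have : (i : ℝ) ≤ ((⌈M * 2 ^ (n + 1)⌉ : ℤ) : ℝ) := by linarith
        exact_mod_cast this
    · obtain ⟨hs, hx⟩ := mem_filter.1 hs
      obtain ⟨i, -, rfl⟩ := mem_image.1 hs
      have hN : (0 : ℚ) < 2 ^ (n + 1) := by positivity
      refine ⟨?_, hx, ?_⟩
      · rw [IsSeg, hg1, hg2]
        gcongr
        linarith
      · rw [segLength, hg1, hg2, ← sub_div, pow_succ]
        apply le_of_eq
        field_simp
        ring

theorem boundedAbove_iff (hF : IsUniverse F) {H : Set (ℕ → ℕ)} (hH : H ⊆ Reals F) :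
    BoundedAbove F H ↔ ∃ M : ℝ, ∀ x ∈ H, val x ≤ M := by
  constructor
  · rintro ⟨y, hy, h⟩
    exact ⟨val y, fun x hx => (rle_iff (hH hx).2 hy.2).1 (h x hx)⟩
  · rintro ⟨M, hM⟩
    obtain ⟨q, hq⟩ := exists_rat_gt M
    obtain ⟨y, hy, hyq⟩ := exists_real_rat hF q
    exact ⟨y, hy, fun x hx => (rle_iff (hH hx).2 hy.2).2 (by rw [hyq]; exact (hM x hx).trans hq.le)⟩

theorem boundedBelow_iff (hF : IsUniverse F) {H : Set (ℕ → ℕ)} (hH : H ⊆ Reals F) :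
    BoundedBelow F H ↔ ∃ M : ℝ, ∀ x ∈ H, M ≤ val x := by
  constructor
  · rintro ⟨y, hy, h⟩
    exact ⟨val y, fun x hx => (rle_iff hy.2 (hH hx).2).1 (h x hx)⟩
  · rintro ⟨M, hM⟩
    obtain ⟨q, hq⟩ := exists_rat_lt M
    obtain ⟨y, hy, hyq⟩ := exists_real_rat hF q
    exact ⟨y, hy, fun x hx => (rle_iff hy.2 (hH hx).2).2 (by rw [hyq]; exact hq.le.trans (hM x hx))⟩

/-- `H` is the closure, within the universe, of the sequence of the real numbers `αⁿ`, up to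
real coincidence: `ClosedAndSeparable` in terms of classical values. -/
structure IsClosureOf (F H : Set (ℕ → ℕ)) (α : ℕ → ℕ) : Prop where
  mem : α ∈ F
  isReal : ∀ n, IsReal (row α n)
  subset : H ⊆ Reals F
  approx : ∀ x ∈ H, ∀ ε > 0, ∃ k, |val x - val (row α k)| < ε
  closed : ∀ x ∈ Reals F, (∀ ε > 0, ∃ k, |val x - val (row α k)| < ε) → ∃ x' ∈ H, val x' = val x

theorem ClosedAndSeparable.exists_isClosureOf (hH : ClosedAndSeparable F H) :
    ∃ α, IsClosureOf F H α := by
  obtain ⟨hsub, α, hα, hreal, h1, h2⟩ := hH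
  refine ⟨α, hα, hreal, hsub, fun x hx ε hε => ?_, fun x hx h => ?_⟩
  · obtain ⟨x', ⟨hx', hc⟩, he⟩ := h1 x hx
    rw [req_iff (hsub hx).2 hx'.2] at he
    obtain ⟨N, hN⟩ := hx'.2.eventually (sub_lt_self _ (half_pos hε))
      (lt_add_of_pos_right _ (half_pos hε))
    obtain ⟨k, hk⟩ := hc N
    obtain ⟨h3, h4⟩ := (contains_iff (hreal k) _).1 hk
    obtain ⟨h5, h6⟩ := hN N le_rfl
    refine ⟨k, ?_⟩
    rw [he, abs_lt]
    constructor <;> linarith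
  · have hmem : x ∈ closureSeq F α := by
      refine ⟨hx, fun n => ?_⟩
      have e1 := hx.2.lo_lt_val n
      have e2 := hx.2.val_lt_hi n
      obtain ⟨k, hk⟩ := h _ (lt_min (sub_pos.2 e1) (sub_pos.2 e2))
      obtain ⟨h3, h4⟩ := lt_min_iff.1 hk
      refine ⟨k, (contains_iff (hreal k) _).2 ?_⟩
      have := abs_lt.1 h3
      have := abs_lt.1 h4
      constructor <;> linarith
    obtain ⟨x', hx', he⟩ := h2 x hmem
    exact ⟨x', hx', ((req_iff hx.2 (hsub hx').2).1 he).symm⟩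

theorem IsClosureOf.row_mem {α : ℕ → ℕ} (hF : IsUniverse F) (hα : IsClosureOf F H α) (k : ℕ) :
    row α k ∈ Reals F :=
  ⟨hF.comp _ hα.mem _ (hF.pair _ (InF.const (α := ℕ) hF k).mem _ (InF.id (α := ℕ) hF).mem),
    hα.isReal k⟩

theorem IsClosureOf.exists_row {α : ℕ → ℕ} (hF : IsUniverse F) (hα : IsClosureOf F H α) (k : ℕ) :
    ∃ x ∈ H, val x = val (row α k) :=
  hα.closed _ (hα.row_mem hF k) fun ε hε => ⟨k, by simpa⟩

/-- Strict enclosure of a row in a computable segment is semidecidable. -/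
theorem Sig.contains_row {ι : Type*} [Primcodable ι] {α : ℕ → ℕ} (hF : IsUniverse F)
    (hα : IsClosureOf F H α) {l r : ι → ℝ} {k : ι → ℕ} (hl : CompQ F l) (hr : CompQ F r)
    (hk : InF F k) : Sig F (fun i => l i < val (row α (k i)) ∧ val (row α (k i)) < r i) := by
  have h1 := (InF.id (α := ι × ℕ) hF).fst hF
  have h2 := (InF.id (α := ι × ℕ) hF).snd hF
  have hs := (InF.of_mem hα.mem).comp hF ((hk.comp hF h1).natPair hF h2)
  refine (Sig.exists hF (((hl.comp hF h1).sig_lt hF (CompQ.lo hF hs)).and hF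
    ((CompQ.hi hF hs).sig_lt hF (hr.comp hF h1)))).congr fun i => ?_
  constructor
  · rintro ⟨e1, e2⟩
    obtain ⟨N, hN⟩ := (hα.isReal (k i)).eventually e1 e2
    exact ⟨N, hN N le_rfl⟩
  · rintro ⟨n, e1, e2⟩
    exact ⟨lt_trans e1 ((hα.isReal (k i)).lo_lt_val n), ((hα.isReal (k i)).val_lt_hi n).trans e2⟩

end

section

open Encodable Finset

variable {F : Set (ℕ → ℕ)} {H : Set (ℕ → ℕ)} {α φ x x' y y' : ℕ → ℕ} {X : Set ℕ}

/-! ### Values of partial continuous functions -/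

theorem MapsOnto.congr (hX : PartialCont X) (hx : IsReal x) (hx' : IsReal x') (hy : IsReal y)
    (h : MapsOnto X x y) (he : val x = val x') : MapsOnto X x' y := by
  intro n
  obtain ⟨m, hm⟩ := h n
  obtain ⟨N, hN⟩ := hx'.eventually ((hx.lo_lt_val m).trans_eq he)
    (he.symm.trans_lt (hx.val_lt_hi m))
  obtain ⟨h1, h2⟩ := hN N le_rfl
  exact ⟨N, hX.2.1 _ _ _ (hx.1 m) (hy.1 n) (hx'.1 N) hm
    ⟨by exact_mod_cast h1.le, by exact_mod_cast h2.le⟩⟩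

/-- A pair of the function whose first segment contains the argument bounds the value. -/
theorem MapsOnto.val_mem (hX : PartialCont X) (hx : IsReal x) (hy : IsReal y)
    (h : MapsOnto X x y) {r s : ℕ} (hrs : Nat.pair r s ∈ X) (hr : Contains r x) :
    (lo s : ℝ) ≤ val y ∧ val y ≤ hi s := by
  obtain ⟨r', s', hr', hs', he⟩ := hX.1 _ hrs
  obtain ⟨rfl, rfl⟩ := Nat.pair_eq_pair.1 he
  obtain ⟨p, hp1, hp2⟩ := hr
  have key : ∀ n, Touches (y n) s := by
    intro n
    obtain ⟨m, hm⟩ := h n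
    -- Two segments of the argument are refined by any later one.
    have e1 : Included (x (max m p)) (x m) :=
      ⟨hx.lo_strictMono.monotone (le_max_left m p), hx.hi_strictAnti.antitone (le_max_left m p)⟩
    have e2 : Included (x (max m p)) r :=
      ⟨hp1.le.trans (hx.lo_strictMono.monotone (le_max_right m p)),
        (hx.hi_strictAnti.antitone (le_max_right m p)).trans hp2.le⟩
    exact hX.2.2.2 _ _ _ (hx.1 _) (hy.1 n) hs'
      (hX.2.1 _ _ _ (hx.1 m) (hy.1 n) (hx.1 _) hm e1) (hX.2.1 _ _ _ hr' hs' (hx.1 _) hrs e2)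
  constructor
  · by_contra! hlt
    obtain ⟨N, hN⟩ := hy.eventually (sub_one_lt _) hlt
    exact absurd (Rat.cast_le.2 (key N).2) (not_le.2 (hN N le_rfl).2)
  · by_contra! hlt
    obtain ⟨N, hN⟩ := hy.eventually hlt (lt_add_one _)
    exact absurd (Rat.cast_le.2 (key N).1) (not_le.2 (hN N le_rfl).1)

theorem MapsOnto.val_unique (hX : PartialCont X) (hx : IsReal x) (hx' : IsReal x')
    (hy : IsReal y) (hy' : IsReal y') (h : MapsOnto X x y) (h' : MapsOnto X x' y')
    (he : val x = val x') : val y = val y' := by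
  have h := h.congr hX hx hx' hy he
  have key : ∀ n, (lo (y' n) : ℝ) ≤ val y ∧ val y ≤ hi (y' n) := fun n => by
    obtain ⟨m, hm⟩ := h' n
    exact h.val_mem hX hx' hy hm (contains_self hx' m)
  apply le_antisymm
  · by_contra! hlt
    obtain ⟨N, hN⟩ := hy'.eventually (sub_one_lt _) hlt
    exact absurd (key N).2 (not_le.2 (hN N le_rfl).2)
  · by_contra! hlt
    obtain ⟨N, hN⟩ := hy'.eventually hlt (lt_add_one _)
    exact absurd (key N).1 (not_le.2 (hN N le_rfl).1)

theorem MapsOnto.exists_pair (hx : IsReal x) (hy : IsReal y) (h : MapsOnto X x y)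
    {a b : ℝ} (ha : a < val y) (hb : val y < b) :
    ∃ r s, Nat.pair r s ∈ X ∧ Contains r x ∧ a < lo s ∧ (hi s : ℝ) < b := by
  obtain ⟨N, hN⟩ := hy.eventually ha hb
  obtain ⟨m, hm⟩ := h N
  exact ⟨_, _, hm, contains_self hx m, hN N le_rfl⟩

theorem EnumCont.exists_value (hH : H ⊆ Reals F) (hφ : EnumCont F H φ) (hx : x ∈ H) :
    ∃ y, IsValue F φ x y := by
  obtain ⟨x', ⟨hx', y, hy, hm⟩, he⟩ := hφ.2.1 x hx
  exact ⟨y, hy, hm.congr hφ.1 hx'.2 (hH hx).2 hy.2 ((req_iff (hH hx).2 hx'.2).1 he).symm⟩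

theorem EnumCont.mem_ran_iff (hH : H ⊆ Reals F) (hφ : EnumCont F H φ) :
    y ∈ ran F (enum φ) ↔ ∃ x ∈ H, IsValue F φ x y := by
  constructor
  · rintro ⟨hy, x, hx, hm⟩
    obtain ⟨x', hx', he⟩ := hφ.2.2 x ⟨hx, y, hy, hm⟩
    exact ⟨x', hx', hy, hm.congr hφ.1 hx.2 (hH hx').2 hy.2 ((req_iff hx.2 (hH hx').2).1 he)⟩
  · rintro ⟨x, hx, hy, hm⟩
    exact ⟨hy, x, hH hx, hm⟩

theorem ran_subset (X : Set ℕ) : ran F X ⊆ Reals F := fun _ h => h.1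

/-! ### Enumerating a function from interval bounds -/

/-- A sequence of functions `f j` is enumerated by the rows of some `φ ∈ F` as soon as
semidecidably many correct interval bounds are known, tight enough at every point of `H`.
The enumerated pairs are cut down so that a pair with a short second segment has its first
segment inside a short segment that contains some `αⁱ`: this forces the domain to be `H`. -/
theorem exists_enumCont (hF : IsUniverse F) (hα : IsClosureOf F H α) {B : ℕ × ℕ × ℕ → Prop}
    (hB : Sig F B) {f : ℕ → ℝ → ℝ}
    (hsound : ∀ j r s, B (j, r, s) → ∀ t : ℝ, lo r ≤ t → t ≤ hi r →
      (lo s : ℝ) ≤ f j t ∧ f j t ≤ hi s)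
    (hcomplete : ∀ j, ∀ x ∈ H, ∀ ε > 0, ∃ r s, B (j, r, s) ∧
      ((lo r : ℝ) < val x ∧ val x < hi r) ∧ (hi s : ℝ) - lo s < ε) :
    ∃ φ ∈ F, ∀ j, EnumCont F H (row φ j) ∧
      ∀ x ∈ H, ∀ y, IsValue F (row φ j) x y → val y = f j (val x) := by
  -- The components of `a` are `j`, the coded pair `⟨r, s⟩`, `r'`, `s'`, `r''` and `i`.
  let P : ((((ℕ × ℕ) × ℕ) × ℕ) × ℕ) × ℕ → Prop := fun a =>
    B (a.1.1.1.1.1, a.1.1.1.2, a.1.1.2) ∧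
    ((lo a.1.1.1.1.2.unpair.1 : ℝ) ≤ hi a.1.1.1.1.2.unpair.1 ∧
      (lo a.1.1.1.1.2.unpair.2 : ℝ) ≤ hi a.1.1.1.1.2.unpair.2) ∧
    ((lo a.1.2 : ℝ) ≤ lo a.1.1.1.1.2.unpair.1 ∧ (hi a.1.1.1.1.2.unpair.1 : ℝ) ≤ hi a.1.2) ∧
    ((lo a.1.1.1.2 : ℝ) ≤ lo a.1.2 ∧ (hi a.1.2 : ℝ) ≤ hi a.1.1.1.2) ∧
    ((lo a.1.1.1.1.2.unpair.2 : ℝ) ≤ lo a.1.1.2 ∧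
      (hi a.1.1.2 : ℝ) ≤ hi a.1.1.1.1.2.unpair.2) ∧
    ((hi a.1.2 : ℝ) - lo a.1.2 ≤ hi a.1.1.1.1.2.unpair.2 - lo a.1.1.1.1.2.unpair.2) ∧
    ((lo a.1.2 : ℝ) < val (row α a.2) ∧ val (row α a.2) < hi a.1.2)
  have hP : Sig F P := by
    have i0 := InF.id (α := ((((ℕ × ℕ) × ℕ) × ℕ) × ℕ) × ℕ) hF
    have i1 := i0.fst hF
    have i2 := i1.fst hF
    have i3 := i2.fst hF
    have i4 := i3.fst hF
    have ij := i4.fst hF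
    have ir := ((i4.snd hF).unpair hF).fst hF
    have is := ((i4.snd hF).unpair hF).snd hF
    have ir' := i3.snd hF
    have is' := i2.snd hF
    have ir'' := i1.snd hF
    have lr := CompQ.lo hF ir
    have ur := CompQ.hi hF ir
    have ls := CompQ.lo hF is
    have us := CompQ.hi hF is
    have lr' := CompQ.lo hF ir'
    have ur' := CompQ.hi hF ir'
    have ls' := CompQ.lo hF is'
    have us' := CompQ.hi hF is'
    have lr'' := CompQ.lo hF ir''
    have ur'' := CompQ.hi hF ir''
    exact (hB.comp hF (ij.prodMk hF (ir'.prodMk hF is'))).and hF <|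
      ((lr.sig_le hF ur).and hF (ls.sig_le hF us)).and hF <|
      ((lr''.sig_le hF lr).and hF (ur.sig_le hF ur'')).and hF <|
      ((lr'.sig_le hF lr'').and hF (ur''.sig_le hF ur')).and hF <|
      ((ls.sig_le hF ls').and hF (us'.sig_le hF us)).and hF <|
      ((ur''.sub hF lr'').sig_le hF (us.sub hF ls)).and hF <|
      Sig.contains_row hF hα lr'' ur'' (i0.snd hF)
  obtain ⟨φ, hφ, hrow⟩ :=
    Sig.exists_rows hF (Sig.exists hF (Sig.exists hF (Sig.exists hF (Sig.exists hF hP))))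
  have hmem : ∀ j r s, Nat.pair r s ∈ enum (row φ j) ↔ ∃ r' s' r'' i, B (j, r', s') ∧
      (IsSeg r ∧ IsSeg s) ∧ Included r r'' ∧ Included r'' r' ∧ Included s' s ∧
      (hi r'' - lo r'' ≤ hi s - lo s) ∧ Contains r'' (row α i) := by
    intro j r s
    rw [hrow]
    simp only [Set.mem_ofPred_eq, P, Nat.unpair_pair, contains_iff (hα.isReal _), Included,
      IsSeg, Rat.cast_le, ← Rat.cast_sub]
  refine ⟨φ, hφ, fun j => ?_⟩
  have hval : ∀ r s, Nat.pair r s ∈ enum (row φ j) → ∀ t : ℝ, lo r ≤ t → t ≤ hi r →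
      (lo s : ℝ) ≤ f j t ∧ f j t ≤ hi s := by
    intro r s hrs t h1 h2
    obtain ⟨r', s', r'', i, hb, -, e1, e2, e3, -⟩ := (hmem j r s).1 hrs
    have l1 : (lo r' : ℝ) ≤ lo r := by exact_mod_cast e2.1.trans e1.1
    have l2 : (hi r : ℝ) ≤ hi r' := by exact_mod_cast e1.2.trans e2.2
    obtain ⟨h3, h4⟩ := hsound j r' s' hb t (l1.trans h1) (h2.trans l2)
    exact ⟨(Rat.cast_le.2 e3.1).trans h3, h4.trans (Rat.cast_le.2 e3.2)⟩
  have hX : PartialCont (enum (row φ j)) := by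
    refine ⟨fun n hn => ?_, fun r s t hr hs ht hrs htr => ?_, fun r s t hr hs ht hrs hst => ?_,
      fun r s t hr hs ht hrs hrt => ?_⟩
    · rw [← Nat.pair_unpair n] at hn
      obtain ⟨_, _, _, _, _, hseg, _⟩ := (hmem _ _ _).1 hn
      exact ⟨_, _, hseg.1, hseg.2, (Nat.pair_unpair n).symm⟩
    · obtain ⟨r', s', r'', i, hb, -, e1, e⟩ := (hmem _ _ _).1 hrs
      exact (hmem _ _ _).2 ⟨r', s', r'', i, hb, ⟨ht, hs⟩,
        ⟨e1.1.trans htr.1, htr.2.trans e1.2⟩, e⟩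
    · obtain ⟨r', s', r'', i, hb, -, e1, e2, e3, e4, e5⟩ := (hmem _ _ _).1 hrs
      exact (hmem _ _ _).2 ⟨r', s', r'', i, hb, ⟨hr, ht⟩, e1, e2,
        ⟨hst.1.trans e3.1, e3.2.trans hst.2⟩, by linarith [hst.1, hst.2], e5⟩
    · have hr' : ((lo r : ℚ) : ℝ) ≤ hi r := by exact_mod_cast hr
      obtain ⟨h1, h2⟩ := hval r s hrs _ le_rfl hr'
      obtain ⟨h3, h4⟩ := hval r t hrt _ le_rfl hr'
      exact ⟨by exact_mod_cast h1.trans h4, by exact_mod_cast h3.trans h2⟩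
  -- A real number `y` that coincides with `f j x` is a value at `x`.
  have hmaps : ∀ x ∈ H, ∀ y, IsReal y → val y = f j (val x) →
      MapsOnto (enum (row φ j)) x y := by
    intro x hx y hy hyf n
    have hxr := (hα.subset hx).2
    have e1 := hy.lo_lt_val n
    have e2 := hy.val_lt_hi n
    obtain ⟨r, s, hb, ⟨h1, h2⟩, hlen⟩ := hcomplete j x hx _ (lt_min (sub_pos.2 e1) (sub_pos.2 e2))
    obtain ⟨h3, h4⟩ := hsound j r s hb _ h1.le h2.le
    obtain ⟨hl1, hl2⟩ := lt_min_iff.1 hlen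
    rw [← hyf] at h3 h4
    obtain ⟨N, hN⟩ := hxr.eventually h1 h2
    have hd : 0 < ((hi (y n) : ℝ) - lo (y n)) / 2 := by linarith
    obtain ⟨M, hM⟩ := hxr.eventually (sub_lt_self _ hd) (lt_add_of_pos_right _ hd)
    have hN := hN _ (le_max_left N M)
    have hM := hM _ (le_max_right N M)
    set m := max N M
    have e3 := hxr.lo_lt_val m
    have e4 := hxr.val_lt_hi m
    obtain ⟨k, hk⟩ := hα.approx x hx _ (lt_min (sub_pos.2 e3) (sub_pos.2 e4))
    obtain ⟨hk1, hk2⟩ := lt_min_iff.1 hk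
    have hk1 := abs_lt.1 hk1
    have hk2 := abs_lt.1 hk2
    refine ⟨m, (hmem _ _ _).2 ⟨r, s, x m, k, hb, ⟨hxr.1 m, hy.1 n⟩, ⟨le_rfl, le_rfl⟩,
      ⟨by exact_mod_cast hN.1.le, by exact_mod_cast hN.2.le⟩, ⟨?_, ?_⟩, ?_, ?_⟩⟩
    · have : (lo (y n) : ℝ) ≤ lo s := by linarith
      exact_mod_cast this
    · have : (hi s : ℝ) ≤ hi (y n) := by linarith
      exact_mod_cast this
    · have : (hi (x m) : ℝ) - lo (x m) ≤ hi (y n) - lo (y n) := by linarith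
      exact_mod_cast this
    · rw [contains_iff (hα.isReal k)]
      constructor <;> linarith
  have hexists : ∀ x ∈ H, ∃ y ∈ Reals F, val y = f j (val x) := by
    intro x hx
    have hxr := hα.subset hx
    -- Search, for each `n`, a bound of length at most `2⁻ⁿ / 8` and a segment of `x` it applies to.
    have i0 := InF.id (α := ℕ × ℕ) hF
    have in' := i0.fst hF
    have ir := ((i0.snd hF).unpair hF).fst hF
    have is := ((((i0.snd hF).unpair hF).snd hF).unpair hF).fst hF
    have im := (InF.of_mem hxr.1).comp hF ((((i0.snd hF).unpair hF).snd hF).unpair hF |>.snd hF)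
    have hS := (hB.comp hF ((InF.const hF j).prodMk hF (ir.prodMk hF is))).and hF <|
      (((CompQ.lo hF ir).sig_lt hF (CompQ.lo hF im)).and hF
        ((CompQ.hi hF im).sig_lt hF (CompQ.hi hF ir))).and hF <|
      ((CompQ.hi hF is).sub hF (CompQ.lo hF is)).sig_le hF
        ((CompQ.twoPow hF in').mul hF (CompQ.const hF (1 / 8)))
    obtain ⟨g, hg, hgs⟩ := Sig.search hF hS fun n => by
      obtain ⟨r, s, hb, ⟨h1, h2⟩, hlen⟩ := hcomplete j x hx (1 / 2 ^ n * (1 / 8)) (by positivity)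
      obtain ⟨N, hN⟩ := hxr.2.eventually h1 h2
      refine ⟨Nat.pair r (Nat.pair s N), ?_⟩
      simp only [Nat.unpair_pair]
      exact ⟨hb, hN N le_rfl, by push_cast; exact hlen.le⟩
    have hsq := (((((InF.of_mem hg).unpair hF).snd hF).unpair hF).fst hF)
    refine exists_real_of_approx hF (CompQ.lo hF hsq) fun n => ?_
    obtain ⟨hb, ⟨h1, h2⟩, hlen⟩ := hgs n
    obtain ⟨h3, h4⟩ := hsound _ _ _ hb _ (h1.trans (hxr.2.lo_lt_val _)).le
      ((hxr.2.val_lt_hi _).trans h2).le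
    push_cast at hlen
    rw [abs_le]
    constructor <;> linarith
  refine ⟨⟨hX, fun x hx => ?_, fun x hx => ?_⟩, fun x hx y hy => ?_⟩
  · obtain ⟨y, hy, hyf⟩ := hexists x hx
    exact ⟨x, ⟨hα.subset hx, y, hy, hmaps x hx y hy.2 hyf⟩,
      (req_iff (hα.subset hx).2 (hα.subset hx).2).2 rfl⟩
  · obtain ⟨hxr, y, hy, hm⟩ := hx
    obtain ⟨x', hx', he⟩ := hα.closed x hxr fun ε hε => by
      obtain ⟨N, hN⟩ := hy.2.eventually (sub_lt_self _ (half_pos hε))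
        (lt_add_of_pos_right _ (half_pos hε))
      obtain ⟨h1, h2⟩ := hN N le_rfl
      obtain ⟨m, hmN⟩ := hm N
      obtain ⟨r', s', r'', i, hb, -, e1, e2, e3, e4, e5⟩ := (hmem _ _ _).1 hmN
      rw [contains_iff (hα.isReal i)] at e5
      have e6 : (lo r'' : ℝ) ≤ lo (x m) := by exact_mod_cast e1.1
      have e7 : (hi (x m) : ℝ) ≤ hi r'' := by exact_mod_cast e1.2
      have e8 : (hi r'' : ℝ) - lo r'' ≤ hi (y N) - lo (y N) := by exact_mod_cast e4
      have e9 := hxr.2.lo_lt_val m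
      have e10 := hxr.2.val_lt_hi m
      refine ⟨i, ?_⟩
      rw [abs_lt]
      constructor <;> linarith
    exact ⟨x', hx', (req_iff hxr.2 (hα.subset hx').2).2 he.symm⟩
  · obtain ⟨y', hy', hyf⟩ := hexists x hx
    rw [← hyf]
    exact hy.2.val_unique hX (hα.subset hx).2 (hα.subset hx).2 hy.1.2 hy'.2
      (hmaps x hx y' hy'.2 hyf) rfl

end

section

open Encodable Finset

variable {F : Set (ℕ → ℕ)} {H : Set (ℕ → ℕ)} {α β : ℕ → ℕ} {x y : ℝ} {m n : ℕ}

/-! ### A partition of unity subordinate to an enumerated covering -/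

/-- The distance from `x` to the complement of the `k`-th segment enumerated by `β`. If `β k = 0`,
so that `β` enumerates nothing at `k`, the truncated `β k - 1 = 0` codes the degenerate segment
`[0, 0]`, and the bump vanishes. -/
noncomputable def bump (β : ℕ → ℕ) (k : ℕ) (x : ℝ) : ℝ :=
  max 0 (min (x - lo (β k - 1)) (hi (β k - 1) - x))

theorem bump_nonneg (β : ℕ → ℕ) (k : ℕ) (x : ℝ) : 0 ≤ bump β k x := le_max_left _ _

theorem bump_pos_iff {k : ℕ} :
    0 < bump β k x ↔ (lo (β k - 1) : ℝ) < x ∧ x < hi (β k - 1) := by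
  simp [bump]

theorem abs_bump_sub_le (β : ℕ → ℕ) (k : ℕ) (x y : ℝ) :
    |bump β k x - bump β k y| ≤ |x - y| := by
  refine (abs_max_sub_max_le_max _ _ _ _).trans (max_le (by simp) ?_)
  refine (abs_min_sub_min_le_max _ _ _ _).trans (max_le (le_of_eq ?_) (le_of_eq ?_))
  · congr 1
    ring
  · rw [abs_sub_comm x y]
    congr 1
    ring

theorem CompQ.bump {ι : Type*} [Primcodable ι] (hF : IsUniverse F) (hβ : β ∈ F) {k : ι → ℕ}
    {q : ι → ℝ} (hk : InF F k) (hq : CompQ F q) :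
    CompQ F fun i => BIM.bump β (k i) (q i) := by
  have hs := ((InF.of_mem hβ).comp hF hk).sub hF (InF.const hF 1)
  have h0 : CompQ F fun _ : ι => (0 : ℝ) := by simpa using CompQ.const hF 0
  exact h0.max hF ((hq.sub hF (CompQ.lo hF hs)).min hF ((CompQ.hi hF hs).sub hF hq))

/-- How deeply `x` is covered by the first `n` segments. The factor `n` makes the depth tend to
infinity at every covered point. -/
noncomputable def depth (β : ℕ → ℕ) (n : ℕ) (x : ℝ) : ℝ := n * ∑ k ∈ range n, bump β k x

theorem depth_zero (β : ℕ → ℕ) (x : ℝ) : depth β 0 x = 0 := by simp [depth]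

theorem depth_mono (β : ℕ → ℕ) (x : ℝ) : Monotone fun n => depth β n x := by
  intro m n hmn
  exact mul_le_mul (by exact_mod_cast hmn)
    (sum_le_sum_of_subset_of_nonneg (range_mono hmn) fun k _ _ => bump_nonneg β k x)
    (sum_nonneg fun k _ => bump_nonneg β k x) (by positivity)

theorem abs_depth_sub_le (β : ℕ → ℕ) (n : ℕ) (x y : ℝ) :
    |depth β n x - depth β n y| ≤ n * n * |x - y| := by
  rw [depth, depth, ← mul_sub, ← sum_sub_distrib, abs_mul, Nat.abs_cast, mul_assoc]
  gcongr
  refine (abs_sum_le_sum_abs _ _).trans ((sum_le_sum fun k _ => abs_bump_sub_le β k x y).trans ?_)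
  simp

theorem exists_lt_depth {k : ℕ} (h : 0 < bump β k x) (c : ℝ) : ∃ n, c < depth β n x := by
  obtain ⟨n, hn⟩ := exists_nat_gt (c / bump β k x)
  rw [div_lt_iff₀ h] at hn
  refine ⟨max n (k + 1), hn.trans_le ?_⟩
  refine mul_le_mul (by exact_mod_cast le_max_left _ _) ?_ h.le (by positivity)
  exact single_le_sum (f := fun k => bump β k x) (fun k _ => bump_nonneg β k x)
    (mem_range.2 (Nat.lt_of_succ_le (le_max_right n (k + 1))))

theorem CompQ.depth {ι : Type*} [Primcodable ι] (hF : IsUniverse F) (hβ : β ∈ F) {n : ι → ℕ}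
    {q : ι → ℝ} (hn : InF F n) (hq : CompQ F q) :
    CompQ F fun i => BIM.depth β (n i) (q i) :=
  (CompQ.natCast hF hn).mul hF (CompQ.sum hF
    (CompQ.bump hF hβ ((InF.id (α := ι × ℕ) hF).snd hF)
      (hq.comp hF ((InF.id (α := ι × ℕ) hF).fst hF))) hn)

/-- The cut-off of `x` at stage `n`: it decreases with `n`, from `1` while the depth is at
most `1` to `0` once the depth is at least `2`. -/
noncomputable def cutoff (β : ℕ → ℕ) (n : ℕ) (x : ℝ) : ℝ := max 0 (min 1 (2 - depth β n x))

theorem cutoff_eq_one (h : depth β n x ≤ 1) : cutoff β n x = 1 := by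
  rw [cutoff, min_eq_left (by linarith), max_eq_right zero_le_one]

theorem cutoff_eq_zero (h : 2 ≤ depth β n x) : cutoff β n x = 0 := by
  rw [cutoff, max_eq_left ((min_le_right _ _).trans (by linarith))]

theorem cutoff_antitone (β : ℕ → ℕ) (x : ℝ) : Antitone fun n => cutoff β n x := fun _ _ hmn =>
  max_le_max le_rfl (min_le_min le_rfl (sub_le_sub_left (depth_mono β x hmn) 2))

theorem abs_cutoff_sub_le (β : ℕ → ℕ) (n : ℕ) (x y : ℝ) :
    |cutoff β n x - cutoff β n y| ≤ n * n * |x - y| := by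
  have h0 : 0 ≤ (n : ℝ) * n * |x - y| := by positivity
  refine (abs_max_sub_max_le_max _ _ _ _).trans (max_le (by simpa using h0) ?_)
  refine (abs_min_sub_min_le_max _ _ _ _).trans (max_le (by simpa using h0) ?_)
  rw [sub_sub_sub_cancel_left, abs_sub_comm]
  exact abs_depth_sub_le β n x y

/-- The `n`-th weight of the partition of unity: it vanishes unless the depth is below `2` at
stage `n` and above `1` at stage `n + 1`. -/
noncomputable def weight (β : ℕ → ℕ) (n : ℕ) (x : ℝ) : ℝ := cutoff β n x - cutoff β (n + 1) x

theorem weight_nonneg (β : ℕ → ℕ) (n : ℕ) (x : ℝ) : 0 ≤ weight β n x :=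
  sub_nonneg.2 (cutoff_antitone β x n.le_succ)

theorem weight_eq_zero_of_two_le (h : 2 ≤ depth β n x) (hmn : n ≤ m) : weight β m x = 0 := by
  rw [weight, cutoff_eq_zero (h.trans (depth_mono β x hmn)),
    cutoff_eq_zero (h.trans (depth_mono β x (hmn.trans m.le_succ))), sub_zero]

theorem weight_eq_zero_of_le_one (h : depth β n x ≤ 1) (hmn : m < n) : weight β m x = 0 := by
  rw [weight, cutoff_eq_one ((depth_mono β x hmn.le).trans h),
    cutoff_eq_one ((depth_mono β x (Nat.succ_le_of_lt hmn)).trans h), sub_self]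

theorem sum_weight (h : 2 ≤ depth β n x) : ∑ m ∈ range n, weight β m x = 1 := by
  simp only [weight]
  rw [sum_range_sub', cutoff_eq_zero h, cutoff_eq_one (by simp [depth_zero]), sub_zero]

/-- A Lipschitz constant of the `n`-th weight. -/
def weightLip (n : ℕ) : ℕ := n * n + (n + 1) * (n + 1)

theorem abs_weight_sub_le (β : ℕ → ℕ) (n : ℕ) (x y : ℝ) :
    |weight β n x - weight β n y| ≤ weightLip n * |x - y| := by
  have h1 := abs_le.1 (abs_cutoff_sub_le β n x y)
  have h2 := abs_le.1 (abs_cutoff_sub_le β (n + 1) x y)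
  rw [weight, weight, weightLip, abs_le]
  push_cast at h1 h2 ⊢
  constructor <;> linarith

theorem CompQ.weight {ι : Type*} [Primcodable ι] (hF : IsUniverse F) (hβ : β ∈ F) {n : ι → ℕ}
    {q : ι → ℝ} (hn : InF F n) (hq : CompQ F q) :
    CompQ F fun i => BIM.weight β (n i) (q i) := by
  have h (k : ℕ) : CompQ F fun _ : ι => (k : ℝ) := CompQ.natCast hF (InF.const hF k)
  have hc : ∀ {n : ι → ℕ}, InF F n → CompQ F fun i => cutoff β (n i) (q i) := fun hn => by
    have := (h 0).max hF ((h 1).min hF ((h 2).sub hF (CompQ.depth hF hβ hn hq)))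
    simpa [cutoff] using this
  exact (hc hn).sub hF (hc (hn.add hF (InF.const hF 1)))

/-- The average of the numbers `c m` with the weights of the partition of unity. At covered
points the sum is finite. -/
noncomputable def blend (β : ℕ → ℕ) (c : ℕ → ℝ) (x : ℝ) : ℝ := ∑' m, c m * weight β m x

theorem blend_eq_sum (c : ℕ → ℝ) (h : 2 ≤ depth β n x) :
    blend β c x = ∑ m ∈ range n, c m * weight β m x :=
  tsum_eq_sum fun m hm => by
    rw [weight_eq_zero_of_two_le h (by simpa using hm), mul_zero]

theorem le_blend {c : ℕ → ℝ} {a : ℝ} (h : 2 ≤ depth β n x)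
    (hc : ∀ m < n, weight β m x ≠ 0 → a ≤ c m) : a ≤ blend β c x := by
  calc a = ∑ m ∈ range n, a * weight β m x := by rw [← mul_sum, sum_weight h, mul_one]
    _ ≤ ∑ m ∈ range n, c m * weight β m x := sum_le_sum fun m hm => by
      by_cases hw : weight β m x = 0
      · simp [hw]
      · exact mul_le_mul_of_nonneg_right (hc m (mem_range.1 hm) hw) (weight_nonneg β m x)
    _ = _ := (blend_eq_sum c h).symm

theorem blend_le {c : ℕ → ℝ} {a : ℝ} (h : 2 ≤ depth β n x)
    (hc : ∀ m < n, weight β m x ≠ 0 → c m ≤ a) : blend β c x ≤ a := by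
  have := le_blend (c := fun m => -c m) h fun m hm hw => neg_le_neg (hc m hm hw)
  rw [blend_eq_sum _ h] at this ⊢
  simp only [neg_mul, sum_neg_distrib] at this
  linarith

theorem blend_mono {c d : ℕ → ℝ} (h : 2 ≤ depth β n x) (hcd : ∀ m, c m ≤ d m) :
    blend β c x ≤ blend β d x := by
  rw [blend_eq_sum _ h, blend_eq_sum _ h]
  exact sum_le_sum fun m _ => mul_le_mul_of_nonneg_right (hcd m) (weight_nonneg β m x)

/-- The tail of the sum that defines `blend` is at most the first coefficient of the tail. -/
theorem abs_blend_sub_sum_le {c : ℕ → ℝ} (hc : Antitone c) (h0 : ∀ m, 0 ≤ c m)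
    (h : 2 ≤ depth β n x) (M : ℕ) :
    |blend β c x - ∑ m ∈ range M, c m * weight β m x| ≤ c M := by
  have h' : 2 ≤ depth β (M + n) x := h.trans (depth_mono β x (Nat.le_add_left n M))
  rw [blend_eq_sum c h', ← sum_range_add_sum_Ico _ (Nat.le_add_right M n), add_sub_cancel_left,
    abs_of_nonneg (sum_nonneg fun m _ => mul_nonneg (h0 m) (weight_nonneg β m x))]
  calc ∑ m ∈ Ico M (M + n), c m * weight β m x
      ≤ ∑ m ∈ Ico M (M + n), c M * weight β m x := sum_le_sum fun m hm =>
        mul_le_mul_of_nonneg_right (hc (mem_Ico.1 hm).1) (weight_nonneg β m x)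
    _ ≤ ∑ m ∈ range (M + n), c M * weight β m x :=
        sum_le_sum_of_subset_of_nonneg (fun m hm => mem_range.2 (mem_Ico.1 hm).2)
          fun m _ _ => mul_nonneg (h0 M) (weight_nonneg β m x)
    _ = c M := by rw [← mul_sum, sum_weight h', mul_one]

theorem abs_sum_weight_sub_le {c : ℕ → ℝ} (h0 : ∀ m, 0 ≤ c m) (M : ℕ) {ℓ : ℝ}
    (hℓ : |x - y| ≤ ℓ) :
    |∑ m ∈ range M, c m * weight β m x - ∑ m ∈ range M, c m * weight β m y| ≤
      (∑ m ∈ range M, c m * weightLip m) * ℓ := by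
  rw [← sum_sub_distrib, sum_mul]
  refine (abs_sum_le_sum_abs _ _).trans (sum_le_sum fun m _ => ?_)
  rw [← mul_sub, abs_mul, abs_of_nonneg (h0 m), mul_assoc]
  exact mul_le_mul_of_nonneg_left ((abs_weight_sub_le β m x y).trans (by gcongr)) (h0 m)

/-- Averages of antitone null sequences are uniformly continuous on the covered points. -/
theorem blend_uniformContinuous {c : ℕ → ℝ} (hc : Antitone c) (h0 : ∀ m, 0 ≤ c m) {ε : ℝ}
    (hlim : ∃ M, 4 * c M < ε) :
    ∃ δ > 0, ∀ x y, (∃ n, 2 ≤ depth β n x) → (∃ n, 2 ≤ depth β n y) → |x - y| ≤ δ →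
      |blend β c x - blend β c y| < ε := by
  obtain ⟨M, hM⟩ := hlim
  have hε : 0 < ε := by linarith [h0 M]
  set L := ∑ m ∈ range M, c m * weightLip m
  have hL : 0 ≤ L := sum_nonneg fun m _ => mul_nonneg (h0 m) (by positivity)
  refine ⟨ε / 4 / (L + 1), by positivity, ?_⟩
  rintro x y ⟨n, hn⟩ ⟨n', hn'⟩ hxy
  have e1 := abs_le.1 (abs_blend_sub_sum_le hc h0 hn M)
  have e2 := abs_le.1 (abs_blend_sub_sum_le hc h0 hn' M)
  have e3 := abs_le.1 (abs_sum_weight_sub_le (β := β) h0 M hxy)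
  have e4 : L * (ε / 4 / (L + 1)) ≤ ε / 4 := by
    rw [mul_div_assoc', div_le_iff₀ (by positivity)]
    nlinarith
  rw [abs_lt]
  constructor <;> linarith

/-! ### The averages as enumerable functions -/

theorem Covers.exists_bump_pos (hH : H ⊆ Reals F) (h : Covers (enum β) H) {x : ℕ → ℕ}
    (hx : x ∈ H) : ∃ k, 0 < bump β k (val x) := by
  obtain ⟨s, ⟨k, hk⟩, hs⟩ := h x hx
  exact ⟨k, bump_pos_iff.2 (by rw [hk]; exact (contains_iff (hH hx).2 s).1 hs)⟩

theorem Covers.exists_lt_depth (hH : H ⊆ Reals F) (h : Covers (enum β) H) {x : ℕ → ℕ}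
    (hx : x ∈ H) (c : ℝ) : ∃ n, c < depth β n (val x) := by
  obtain ⟨k, hk⟩ := h.exists_bump_pos hH hx
  exact BIM.exists_lt_depth hk c

theorem exists_depth_eq_zero (hH : H ⊆ Reals F) (h : ¬ Covers (enumUpTo β n) H) :
    ∃ x ∈ H, depth β n (val x) = 0 := by
  simp only [Covers, not_forall] at h
  obtain ⟨x, hx, h⟩ := h
  refine ⟨x, hx, ?_⟩
  rw [depth, sum_eq_zero, mul_zero]
  intro k hk
  refine le_antisymm (not_lt.1 fun hpos => h ?_) (bump_nonneg β k _)
  have hpos := bump_pos_iff.1 hpos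
  refine ⟨β k - 1, ⟨k, mem_range.1 hk, ?_⟩, (contains_iff (hH hx).2 _).2 hpos⟩
  -- If `β k = 0`, then `hpos` says that `0 < val x < 0`.
  have : β k ≠ 0 := by
    intro h0
    rw [h0] at hpos
    simp [lo, hi, ratOf] at hpos
    linarith
  omega

/-- The averages of a computable double sequence of rational numbers are enumerated by the rows
of a function of `F`. -/
theorem exists_enumCont_blend_rows (hF : IsUniverse F) (hα : IsClosureOf F H α) (hβ : β ∈ F)
    (hcov : Covers (enum β) H) {c : ℕ × ℕ → ℝ} (hc : CompQ F c) (h0 : ∀ p, 0 ≤ c p) :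
    ∃ φ ∈ F, ∀ j, EnumCont F H (row φ j) ∧
      ∀ x ∈ H, ∀ y, IsValue F (row φ j) x y →
        val y = blend β (fun m => c (j, m)) (val x) := by
  -- The bounds come from the value at the left endpoint of the segment `r` of arguments and the
  -- Lipschitz constants of the weights, once `r` is deep enough in the covering.
  let S : ℕ → ℕ → ℝ → ℝ := fun j n q => ∑ m ∈ range n, c (j, m) * weight β m q
  let L : ℕ → ℕ → ℝ := fun j n => ∑ m ∈ range n, c (j, m) * weightLip m
  have hL0 : ∀ j n, 0 ≤ L j n := fun j n => sum_nonneg fun m _ =>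
    mul_nonneg (h0 _) (by positivity)
  let P : (ℕ × ℕ × ℕ) × ℕ → Prop := fun a =>
    2 ≤ depth β a.2 (lo a.1.2.1) - (a.2 * a.2 : ℕ) * ((hi a.1.2.1 : ℝ) - lo a.1.2.1) ∧
    ((lo a.1.2.2 : ℝ) ≤ S a.1.1 a.2 (lo a.1.2.1) - L a.1.1 a.2 * ((hi a.1.2.1 : ℝ) - lo a.1.2.1) ∧
      S a.1.1 a.2 (lo a.1.2.1) + L a.1.1 a.2 * ((hi a.1.2.1 : ℝ) - lo a.1.2.1) ≤ hi a.1.2.2)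
  have hP : Sig F P := by
    have i0 := InF.id (α := (ℕ × ℕ × ℕ) × ℕ) hF
    have hj := (i0.fst hF).fst hF
    have hr := ((i0.fst hF).snd hF).fst hF
    have hs := ((i0.fst hF).snd hF).snd hF
    have hn := i0.snd hF
    have k0 := InF.id (α := ((ℕ × ℕ × ℕ) × ℕ) × ℕ) hF
    have hm := k0.snd hF
    have one := InF.const (α := ((ℕ × ℕ × ℕ) × ℕ) × ℕ) hF 1
    have hm1 := hm.add hF one
    have hcm := hc.comp hF ((hj.comp hF (k0.fst hF)).prodMk hF hm)
    have len := (CompQ.hi hF hr).sub hF (CompQ.lo hF hr)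
    have hS := CompQ.sum hF
      (hcm.mul hF (CompQ.weight hF hβ hm (CompQ.lo hF (hr.comp hF (k0.fst hF))))) hn
    have hL := CompQ.sum hF
      (hcm.mul hF (CompQ.natCast hF ((hm.mul hF hm).add hF (hm1.mul hF hm1)))) hn
    have two := CompQ.natCast hF (InF.const (α := (ℕ × ℕ × ℕ) × ℕ) hF 2)
    exact (two.sig_le hF ((CompQ.depth hF hβ hn (CompQ.lo hF hr)).sub hF
        ((CompQ.natCast hF (hn.mul hF hn)).mul hF len))).and hF <|
      ((CompQ.lo hF hs).sig_le hF (hS.sub hF (hL.mul hF len))).and hF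
        ((hS.add hF (hL.mul hF len)).sig_le hF (CompQ.hi hF hs))
  refine exists_enumCont hF hα (Sig.exists hF hP) (f := fun j => blend β fun m => c (j, m)) ?_ ?_
  · rintro j r s ⟨n, h1, h2, h3⟩ t ht1 ht2
    have hd : |t - lo r| ≤ (hi r : ℝ) - lo r := by
      rw [abs_of_nonneg (sub_nonneg.2 ht1)]
      linarith
    have e1 := abs_le.1 (abs_depth_sub_le β n t (lo r))
    have e2 : (n : ℝ) * n * |t - lo r| ≤ n * n * ((hi r : ℝ) - lo r) := by gcongr
    have e3 : 2 ≤ depth β n t := by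
      push_cast at h1
      linarith
    have e4 := abs_le.1 (abs_sum_weight_sub_le (β := β) (fun m => h0 (j, m)) n hd)
    simp only [S, L] at h2 h3
    rw [blend_eq_sum _ e3]
    constructor <;> linarith
  · intro j x hx ε hε
    obtain ⟨n, hn⟩ := hcov.exists_lt_depth hα.subset hx 2
    have hL := hL0 j n
    obtain ⟨δ, hδ, hδ1, hδ2⟩ : ∃ δ > 0, 2 * ((n : ℝ) * n * δ) ≤ depth β n (val x) - 2 ∧
        2 * (L j n * δ) ≤ ε / 2 := by
      refine ⟨min ((depth β n (val x) - 2) / (2 * (n * n) + 1)) (ε / 2 / (2 * L j n + 1)),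
        lt_min (div_pos (by linarith) (by positivity)) (by positivity), ?_, ?_⟩
      · have h1 : 0 < 2 * ((n : ℝ) * n) + 1 := by positivity
        have h2 := (le_div_iff₀ h1).1 (min_le_left ((depth β n (val x) - 2) / (2 * (n * n) + 1))
          (ε / 2 / (2 * L j n + 1)))
        have h3 : 0 ≤ min ((depth β n (val x) - 2) / (2 * (n * n) + 1))
          (ε / 2 / (2 * L j n + 1)) := le_min (div_nonneg (by linarith) h1.le) (by positivity)
        linarith
      · have h1 : 0 < 2 * L j n + 1 := by positivity
        have h2 := (le_div_iff₀ h1).1 (min_le_right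
          ((depth β n (val x) - 2) / (2 * (n * n) + 1)) (ε / 2 / (2 * L j n + 1)))
        have h3 : 0 ≤ min ((depth β n (val x) - 2) / (2 * (n * n) + 1))
          (ε / 2 / (2 * L j n + 1)) := le_min (div_nonneg (by linarith) (by positivity))
            (by positivity)
        linarith
    obtain ⟨r, hr, hr1, hr2, hr3, hr4⟩ := exists_isSeg_between
      (sub_lt_self (val x) (half_pos hδ)) (lt_add_of_pos_right (val x) (half_pos hδ))
    have hlen : (hi r : ℝ) - lo r ≤ δ := by linarith
    have hlen0 : 0 ≤ (hi r : ℝ) - lo r := by linarith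
    obtain ⟨p, hp1, hp2⟩ := exists_rat_btwn
      (sub_lt_self (S j n (lo r) - L j n * ((hi r : ℝ) - lo r)) (by positivity : 0 < ε / 4))
    obtain ⟨q, hq1, hq2⟩ := exists_rat_btwn
      (lt_add_of_pos_right (S j n (lo r) + L j n * ((hi r : ℝ) - lo r))
        (by positivity : 0 < ε / 4))
    obtain ⟨s, rfl, rfl⟩ := exists_segment p q
    have e1 : (n : ℝ) * n * ((hi r : ℝ) - lo r) ≤ n * n * δ := by gcongr
    have e2 : L j n * ((hi r : ℝ) - lo r) ≤ L j n * δ := by gcongr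
    refine ⟨r, s, ⟨n, ?_, hp2.le, hq1.le⟩, ⟨hr2, hr3⟩, by linarith⟩
    have e3 := abs_le.1 (abs_depth_sub_le β n (val x) (lo r))
    have e4 : (n : ℝ) * n * |val x - lo r| ≤ n * n * ((hi r : ℝ) - lo r) := by
      gcongr
      rw [abs_of_nonneg (by linarith)]
      linarith
    dsimp only
    push_cast
    linarith

theorem exists_enumCont_blend (hF : IsUniverse F) (hα : IsClosureOf F H α) (hβ : β ∈ F)
    (hcov : Covers (enum β) H) {c : ℕ → ℝ} (hc : CompQ F c) (h0 : ∀ m, 0 ≤ c m) :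
    ∃ φ ∈ F, EnumCont F H φ ∧
      ∀ x ∈ H, ∀ y, IsValue F φ x y → val y = blend β c (val x) := by
  obtain ⟨φ, hφ, h⟩ := exists_enumCont_blend_rows hF hα hβ hcov
    (hc.comp hF ((InF.id (α := ℕ × ℕ) hF).snd hF)) fun p => h0 _
  exact ⟨row φ 0, hF.comp _ hφ _ (hF.pair _ hF.zero _ (InF.id (α := ℕ) hF).mem), h 0⟩

end

section

open Encodable Finset

variable {F : Set (ℕ → ℕ)} {H : Set (ℕ → ℕ)} {α φ : ℕ → ℕ}

/-! ### Consequences of the Heine–Borel property -/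

theorem HeineBorel.exists_finset (hF : IsUniverse F) (hHB : HeineBorel F H) {p : ℕ → Prop}
    (hp : Sig F p) (hcov : ∀ x ∈ H, ∃ s, p s ∧ Contains s x) :
    ∃ B : Finset ℕ, (∀ s ∈ B, p s) ∧ ∀ x ∈ H, ∃ s ∈ B, Contains s x := by
  classical
  obtain ⟨φ, hφ, he⟩ := hp.exists_enum hF
  obtain ⟨n, hn⟩ := hHB φ hφ (by rw [he]; exact hcov)
  refine ⟨((range n).image fun i => φ i - 1).filter p, fun s hs => (mem_filter.1 hs).2,
    fun x hx => ?_⟩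
  obtain ⟨s, ⟨m, hm, hms⟩, hsx⟩ := hn x hx
  have hs : s ∈ enum φ := ⟨m, hms⟩
  rw [he] at hs
  exact ⟨s, mem_filter.2 ⟨mem_image.2 ⟨m, mem_range.2 hm, by simp [hms]⟩, hs⟩, hsx⟩

theorem one_div_two_pow_anti {m n : ℕ} (h : m ≤ n) : 1 / (2 : ℝ) ^ n ≤ 1 / 2 ^ m :=
  one_div_le_one_div_of_le (by positivity) (pow_le_pow_right₀ one_le_two h)

theorem HeineBorel.totBdd (hF : IsUniverse F) (hα : IsClosureOf F H α) (hHB : HeineBorel F H) :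
    TotBdd H := by
  -- The covering by all segments, given by a predicate that is always true.
  obtain ⟨B, -, hB⟩ := hHB.exists_finset hF
    (Sig.le hF (InF.id (α := ℕ) hF) (InF.id hF))
    fun x hx => ⟨x 0, le_rfl, contains_self (hα.subset hx).2 0⟩
  refine (totBdd_iff hα.subset).2 ⟨∑ r ∈ B, (|(lo r : ℝ)| + |(hi r : ℝ)|), fun x hx => ?_⟩
  obtain ⟨r, hr, hrx⟩ := hB x hx
  obtain ⟨h1, h2⟩ := (contains_iff (hα.subset hx).2 r).1 hrx
  refine le_trans ?_ (single_le_sum (f := fun r => |(lo r : ℝ)| + |(hi r : ℝ)|)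
    (fun _ _ => by positivity) hr)
  exact (abs_le_max_abs_abs h1.le h2.le).trans
    (max_le_add_of_nonneg (abs_nonneg _) (abs_nonneg _))

theorem HeineBorel.totBdd_ran (hF : IsUniverse F) (hα : IsClosureOf F H α)
    (hHB : HeineBorel F H) (hφ : φ ∈ F) (hc : EnumCont F H φ) : TotBdd (ran F (enum φ)) := by
  have i0 := InF.id (α := ℕ × ℕ) hF
  have hS := Sig.exists hF (Sig.mem_enum hF hφ ((i0.fst hF).natPair hF (i0.snd hF)))
  obtain ⟨B, hBp, hB⟩ := hHB.exists_finset hF hS fun x hx => by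
    obtain ⟨y, hy⟩ := hc.exists_value hα.subset hx
    obtain ⟨r, s, hrs, hr, -⟩ := hy.2.exists_pair (hα.subset hx).2 hy.1.2 (sub_one_lt _)
      (lt_add_one _)
    exact ⟨r, ⟨s, hrs⟩, hr⟩
  choose! g hg using hBp
  refine (totBdd_iff (ran_subset _)).2
    ⟨∑ r ∈ B, (|(lo (g r) : ℝ)| + |(hi (g r) : ℝ)|), fun y hy => ?_⟩
  obtain ⟨x, hx, hy⟩ := (hc.mem_ran_iff hα.subset).1 hy
  obtain ⟨r, hr, hrx⟩ := hB x hx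
  obtain ⟨h1, h2⟩ := hy.2.val_mem hc.1 (hα.subset hx).2 hy.1.2 (hg r hr) hrx
  refine le_trans ?_ (single_le_sum (f := fun r => |(lo (g r) : ℝ)| + |(hi (g r) : ℝ)|)
    (fun _ _ => by positivity) hr)
  exact (abs_le_max_abs_abs h1 h2).trans (max_le_add_of_nonneg (abs_nonneg _) (abs_nonneg _))

/-- The Lebesgue number of a finite covering by segments `r` whose double lies in a segment on
which the function varies little is a modulus of uniform continuity. -/
theorem HeineBorel.unifCont (hF : IsUniverse F) (hα : IsClosureOf F H α)
    (hHB : HeineBorel F H) (hφ : φ ∈ F) (hc : EnumCont F H φ) : UnifCont F H φ := by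
  intro m
  have i0 := InF.id (α := (ℕ × ℕ) × ℕ) hF
  have hr := (i0.fst hF).fst hF
  have hr' := (i0.fst hF).snd hF
  have hs := i0.snd hF
  have len := (CompQ.hi hF hr).sub hF (CompQ.lo hF hr)
  have hS := Sig.exists hF (Sig.exists hF ((Sig.mem_enum hF hφ (hr'.natPair hF hs)).and hF <|
    ((CompQ.lo hF hr).sig_lt hF (CompQ.hi hF hr)).and hF <|
    (((CompQ.lo hF hr').sig_lt hF ((CompQ.lo hF hr).sub hF len)).and hF
      (((CompQ.hi hF hr).add hF len).sig_lt hF (CompQ.hi hF hr'))).and hF <|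
    ((CompQ.hi hF hs).sub hF (CompQ.lo hF hs)).sig_lt hF
      (CompQ.twoPow hF (InF.const hF m))))
  obtain ⟨B, hBp, hB⟩ := hHB.exists_finset hF hS fun x hx => by
    have hxr := (hα.subset hx).2
    obtain ⟨y, hy⟩ := hc.exists_value hα.subset hx
    have h2 : 0 < 1 / (2 : ℝ) ^ m / 2 := by positivity
    obtain ⟨r', s, hrs, hr', h3, h4⟩ := hy.2.exists_pair hxr hy.1.2 (sub_lt_self _ h2)
      (lt_add_of_pos_right _ h2)
    obtain ⟨h5, h6⟩ := (contains_iff hxr _).1 hr'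
    obtain ⟨g, hg⟩ : ∃ g, g = min (val x - lo r') (hi r' - val x) / 3 := ⟨_, rfl⟩
    have hg0 : 0 < g := by
      rw [hg]
      exact div_pos (lt_min (by linarith) (by linarith)) (by norm_num)
    have hg1 : 3 * g ≤ val x - lo r' := by
      rw [hg]
      linarith [min_le_left (val x - lo r') (hi r' - val x)]
    have hg2 : 3 * g ≤ hi r' - val x := by
      rw [hg]
      linarith [min_le_right (val x - lo r') (hi r' - val x)]
    obtain ⟨r, hr, e1, e2, e3, e4⟩ := exists_isSeg_between (sub_lt_self (val x) hg0)
      (lt_add_of_pos_right (val x) hg0)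
    exact ⟨r, ⟨r', s, hrs, by linarith, ⟨by linarith, by linarith⟩, by linarith⟩,
      (contains_iff hxr _).2 ⟨e2, e3⟩⟩
  choose! r' s hrs hlen hdouble hs using hBp
  have hn : ∀ r ∈ B, ∃ n : ℕ, 1 / (2 : ℝ) ^ n < hi r - lo r := fun r hr =>
    exists_one_div_two_pow_lt (sub_pos.2 (hlen r hr))
  choose! n hn using hn
  refine ⟨B.sup n, fun x hx x' hx' y y' hy hy' hd => ?_⟩
  rw [distLt_iff (hα.subset hx).2 (hα.subset hx').2] at hd
  rw [distLt_iff hy.1.2 hy'.1.2]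
  obtain ⟨r, hr, hrx⟩ := hB x hx
  obtain ⟨h1, h2⟩ := (contains_iff (hα.subset hx).2 r).1 hrx
  have h3 := one_div_two_pow_anti (le_sup (f := n) hr)
  have h4 := hn r hr
  obtain ⟨h5, h6⟩ := hdouble r hr
  have h7 := hs r hr
  push_cast at hd ⊢
  have h8 := abs_lt.1 hd
  dsimp only at h5 h6 h7
  have hx1 : Contains (r' r) x := (contains_iff (hα.subset hx).2 _).2
    ⟨by linarith, by linarith⟩
  have hx2 : Contains (r' r) x' := (contains_iff (hα.subset hx').2 _).2
    ⟨by linarith, by linarith⟩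
  obtain ⟨h9, h10⟩ := hy.2.val_mem hc.1 (hα.subset hx).2 hy.1.2 (hrs r hr) hx1
  obtain ⟨h11, h12⟩ := hy'.2.val_mem hc.1 (hα.subset hx').2 hy'.1.2 (hrs r hr) hx2
  rw [abs_lt]
  constructor <;> linarith

theorem almostHasMax_of_forall_le {A : Set (ℕ → ℕ)} (hA : A ⊆ Reals F) {y : ℕ → ℕ} (hy : y ∈ A)
    (h : ∀ x ∈ A, val x ≤ val y) : AlmostHasMax F A :=
  ⟨y, hA hy, ⟨fun x hx => (rle_iff (hA hx).2 (hA hy).2).2 (h x hx), fun _ _ hz => ⟨y, hy, hz⟩⟩,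
    fun _ _ hz => hz y hy⟩

/-- If the maximum were not attained, then the segments on which the function stays below its
value at some `αᵏ` would form an enumerable covering without a finite subcovering. -/
theorem HeineBorel.almostHasMax (hF : IsUniverse F) (hα : IsClosureOf F H α)
    (hHB : HeineBorel F H) (hφ : φ ∈ F) (hc : EnumCont F H φ) :
    AlmostHasMax F (ran F (enum φ)) := by
  by_contra hno
  have hno : ∀ y ∈ ran F (enum φ), ∃ y' ∈ ran F (enum φ), val y < val y' := by
    intro y hy
    by_contra! h
    exact hno (almostHasMax_of_forall_le (ran_subset _) hy h)
  have i0 := InF.id (α := (((ℕ × ℕ) × ℕ) × ℕ) × ℕ) hF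
  have hr := (((i0.fst hF).fst hF).fst hF).fst hF
  have hs := (((i0.fst hF).fst hF).fst hF).snd hF
  have hr' := ((i0.fst hF).fst hF).snd hF
  have hs' := (i0.fst hF).snd hF
  have hS := Sig.exists hF (Sig.exists hF (Sig.exists hF (Sig.exists hF <|
    (Sig.mem_enum hF hφ (hr.natPair hF hs)).and hF <|
    (Sig.mem_enum hF hφ (hr'.natPair hF hs')).and hF <|
    ((CompQ.hi hF hs).sig_lt hF (CompQ.lo hF hs')).and hF <|
    Sig.contains_row hF hα (CompQ.lo hF hr') (CompQ.hi hF hr') (i0.snd hF))))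
  obtain ⟨B, hBp, hB⟩ := hHB.exists_finset hF hS fun x hx => by
    have hxr := (hα.subset hx).2
    obtain ⟨y, hy⟩ := hc.exists_value hα.subset hx
    obtain ⟨y', hy', hlt⟩ := hno y ((hc.mem_ran_iff hα.subset).2 ⟨x, hx, hy⟩)
    obtain ⟨x', hx', hy'⟩ := (hc.mem_ran_iff hα.subset).1 hy'
    have hxr' := (hα.subset hx').2
    obtain ⟨r, s, hrs, hrx, -, h1⟩ := hy.2.exists_pair hxr hy.1.2 (sub_one_lt _)
      (left_lt_add_div_two.2 hlt)
    obtain ⟨r', s', hrs', hrx', h2, -⟩ := hy'.2.exists_pair hxr' hy'.1.2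
      (add_div_two_lt_right.2 hlt) (lt_add_one _)
    obtain ⟨h3, h4⟩ := (contains_iff hxr' _).1 hrx'
    obtain ⟨k, hk⟩ := hα.approx x' hx' _ (lt_min (sub_pos.2 h3) (sub_pos.2 h4))
    obtain ⟨h5, h6⟩ := lt_min_iff.1 hk
    have h5 := abs_lt.1 h5
    have h6 := abs_lt.1 h6
    exact ⟨r, ⟨s, r', s', k, hrs, hrs', h1.trans h2, by dsimp only; linarith,
      by dsimp only; linarith⟩, hrx⟩
  have hBp : ∀ r ∈ B, ∃ s, Nat.pair r s ∈ enum φ ∧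
      ∃ y ∈ ran F (enum φ), (hi s : ℝ) < val y := by
    intro r hr
    obtain ⟨s, r', s', k, hrs, hrs', hlt, hk⟩ := hBp r hr
    obtain ⟨x, hx, hxk⟩ := hα.exists_row hF k
    dsimp only at hk hlt
    rw [← hxk, ← contains_iff (hα.subset hx).2] at hk
    obtain ⟨y, hy⟩ := hc.exists_value hα.subset hx
    exact ⟨s, hrs, y, (hc.mem_ran_iff hα.subset).2 ⟨x, hx, hy⟩,
      hlt.trans_le (hy.2.val_mem hc.1 (hα.subset hx).2 hy.1.2 hrs' hk).1⟩
  choose! s hrs y hy hlt using hBp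
  have hne : B.Nonempty := by
    obtain ⟨x, hx, -⟩ := hα.exists_row hF 0
    obtain ⟨r, hr, -⟩ := hB x hx
    exact ⟨r, hr⟩
  obtain ⟨t, ht, hmax⟩ := B.exists_max_image (fun r => val (y r)) hne
  obtain ⟨x, hx, hxy⟩ := (hc.mem_ran_iff hα.subset).1 (hy t ht)
  obtain ⟨r, hr, hrx⟩ := hB x hx
  have h1 := (hxy.2.val_mem hc.1 (hα.subset hx).2 hxy.1.2 (hrs r hr) hrx).2
  exact absurd (hmax r hr) (not_le.2 (h1.trans_lt (hlt r hr)))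

theorem HeineBorel.posBoundedAway (hF : IsUniverse F) (hα : IsClosureOf F H α)
    (hHB : HeineBorel F H) (hφ : φ ∈ F) (hc : EnumCont F H φ) (hpos : PosOn F H φ) :
    PosBoundedAway F H φ := by
  have i0 := InF.id (α := ℕ × ℕ) hF
  have hS := Sig.exists hF ((Sig.mem_enum hF hφ ((i0.fst hF).natPair hF (i0.snd hF))).and hF
    ((CompQ.const hF 0).sig_lt hF (CompQ.lo hF (i0.snd hF))))
  obtain ⟨B, hBp, hB⟩ := hHB.exists_finset hF hS fun x hx => by
    obtain ⟨y, hy⟩ := hc.exists_value hα.subset hx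
    obtain ⟨r, s, hrs, hr, h1, -⟩ := hy.2.exists_pair (hα.subset hx).2 hy.1.2
      ((ratLt_iff hy.1.2 0).1 (hpos x hx y hy)) (lt_add_one _)
    exact ⟨r, ⟨s, hrs, h1⟩, hr⟩
  choose! s hrs hs using hBp
  have hm : ∀ r ∈ B, ∃ m : ℕ, 1 / (2 : ℝ) ^ m < lo (s r) := fun r hr =>
    exists_one_div_two_pow_lt (by simpa using hs r hr)
  choose! m hm using hm
  refine ⟨B.sup m, fun x hx y hy => (ratLt_iff hy.1.2 _).2 ?_⟩
  obtain ⟨r, hr, hrx⟩ := hB x hx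
  push_cast
  exact (one_div_two_pow_anti (le_sup (f := m) hr)).trans_lt
    ((hm r hr).trans_le (hy.2.val_mem hc.1 (hα.subset hx).2 hy.1.2 (hrs r hr) hrx).1)

theorem HeineBorel.dini (hF : IsUniverse F) (hα : IsClosureOf F H α)
    (hHB : HeineBorel F H) : Dini F H := by
  intro φ hφ hc hanti hlim m
  have i0 := InF.id (α := (ℕ × ℕ) × ℕ) hF
  have hr := (i0.fst hF).fst hF
  have hn := (i0.fst hF).snd hF
  have hs := i0.snd hF
  have hS := Sig.exists hF (Sig.exists hF ((Sig.mem_enum_row hF hφ hn (hr.natPair hF hs)).and hF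
    ((CompQ.hi hF hs).sig_lt hF (CompQ.twoPow hF (InF.const hF m)))))
  obtain ⟨B, hBp, hB⟩ := hHB.exists_finset hF hS fun x hx => by
    obtain ⟨n, hn⟩ := hlim (m + 1) x hx
    obtain ⟨y, hy⟩ := (hc n).exists_value hα.subset hx
    have h1 := (leRat_iff hy.1.2 _).1 (hn y hy)
    have h2 : 1 / (2 : ℝ) ^ (m + 1) < 1 / 2 ^ m :=
      one_div_lt_one_div_of_lt (by positivity) (pow_lt_pow_right₀ one_lt_two m.lt_succ_self)
    push_cast at h1
    obtain ⟨r, s, hrs, hr, -, h3⟩ := hy.2.exists_pair (hα.subset hx).2 hy.1.2 (sub_one_lt _)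
      (h1.trans_lt h2)
    exact ⟨r, ⟨n, s, hrs, h3⟩, hr⟩
  choose! n s hrs hs using hBp
  have hle : ∀ x ∈ H, ∀ k l, k ≤ l → ∀ y y', IsValue F (row φ k) x y →
      IsValue F (row φ l) x y' → val y' ≤ val y := by
    intro x hx k l hkl
    induction l, hkl using Nat.le_induction with
    | base =>
      intro y y' hy hy'
      exact (hy'.2.val_unique (hc k).1 (hα.subset hx).2 (hα.subset hx).2 hy'.1.2 hy.1.2 hy.2
        rfl).le
    | succ l _ ih =>
      intro y y' hy hy'
      obtain ⟨z, hz⟩ := (hc l).exists_value hα.subset hx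
      exact ((rle_iff hy'.1.2 hz.1.2).1 (hanti l x hx z y' hz hy').1).trans (ih y z hy hz)
  refine ⟨B.sup n, fun x hx y hy => (leRat_iff hy.1.2 _).2 ?_⟩
  obtain ⟨r, hr, hrx⟩ := hB x hx
  obtain ⟨z, hz⟩ := (hc (n r)).exists_value hα.subset hx
  have h1 := (hz.2.val_mem (hc (n r)).1 (hα.subset hx).2 hz.1.2 (hrs r hr) hrx).2
  push_cast
  exact (hle x hx _ _ (le_sup (f := n) hr) z y hz hy).trans (h1.trans (hs r hr).le)

end

section

open Encodable Finset Filter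

variable {F : Set (ℕ → ℕ)} {H : Set (ℕ → ℕ)} {α β φ : ℕ → ℕ}

/-! ### Functions that detect a covering without a finite subcovering -/

theorem le_blend_of_depth_le_one {c : ℕ → ℝ} {a x : ℝ} {k n : ℕ} (hn : 2 ≤ depth β n x)
    (hk : depth β k x ≤ 1) (hc : ∀ m, k ≤ m → m < n → a ≤ c m) : a ≤ blend β c x :=
  le_blend hn fun m hm hw => hc m (not_lt.1 fun h => hw (weight_eq_zero_of_le_one hk h)) hm

theorem blend_le_of_depth_le_one {c : ℕ → ℝ} {a x : ℝ} {k n : ℕ} (hn : 2 ≤ depth β n x)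
    (hk : depth β k x ≤ 1) (hc : ∀ m, k ≤ m → m < n → c m ≤ a) : blend β c x ≤ a :=
  blend_le hn fun m hm hw => hc m (not_lt.1 fun h => hw (weight_eq_zero_of_le_one hk h)) hm

theorem heineBorel_of_boundedAbove (hF : IsUniverse F) (hα : IsClosureOf F H α)
    (h : ∀ φ ∈ F, EnumCont F H φ → BoundedAbove F (ran F (enum φ))) : HeineBorel F H := by
  intro β hβ hcov
  by_contra! hno
  obtain ⟨φ, hφ, hc, hv⟩ := exists_enumCont_blend hF hα hβ hcov
    (CompQ.natCast hF (InF.id (α := ℕ) hF)) fun m => m.cast_nonneg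
  obtain ⟨M, hM⟩ := (boundedAbove_iff hF (ran_subset _)).1 (h φ hφ hc)
  obtain ⟨n, hn⟩ := exists_nat_gt M
  obtain ⟨x, hx, hd⟩ := exists_depth_eq_zero hα.subset (hno n)
  obtain ⟨N, hN⟩ := hcov.exists_lt_depth hα.subset hx 2
  obtain ⟨y, hy⟩ := hc.exists_value hα.subset hx
  have h1 := hM y ((hc.mem_ran_iff hα.subset).2 ⟨x, hx, hy⟩)
  rw [hv x hx y hy] at h1
  have h2 : (n : ℝ) ≤ blend β (fun m => m) (val x) :=
    le_blend_of_depth_le_one hN.le (hd.trans_le zero_le_one) fun m hm _ => by exact_mod_cast hm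
  linarith

/-- The weights `m / (m + 1)` give a function with values below `1`, whose supremum is `1`. -/
theorem heineBorel_of_almostHasMax (hF : IsUniverse F) (hα : IsClosureOf F H α)
    (h : ∀ φ ∈ F, EnumCont F H φ → IsBdd F (ran F (enum φ)) → AlmostHasMax F (ran F (enum φ))) :
    HeineBorel F H := by
  intro β hβ hcov
  by_contra! hno
  have hcomp : CompQ F fun m : ℕ => (m : ℝ) / (m + 1) := by
    simpa using CompQ.mkRat hF (InF.id (α := ℕ) hF) (InF.const hF 0) (InF.id hF)
  obtain ⟨φ, hφ, hc, hv⟩ := exists_enumCont_blend hF hα hβ hcov hcomp fun m => by positivity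
  have hlt : ∀ y ∈ ran F (enum φ), 0 ≤ val y ∧ val y < 1 := by
    intro y hy
    obtain ⟨x, hx, hy⟩ := (hc.mem_ran_iff hα.subset).1 hy
    obtain ⟨N, hN⟩ := hcov.exists_lt_depth hα.subset hx 2
    rw [hv x hx y hy]
    refine ⟨le_blend hN.le fun m _ _ => by positivity, lt_of_le_of_lt
      (blend_le (a := 1 - 1 / (N + 1)) hN.le fun m hm _ => ?_) (sub_lt_self _ (by positivity))⟩
    have h1 : (1 : ℝ) / (N + 1) ≤ 1 / (m + 1) :=
      one_div_le_one_div_of_le (by positivity) (by exact_mod_cast Nat.succ_le_succ hm.le)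
    have h2 : (m : ℝ) / (m + 1) = 1 - 1 / (m + 1) := by
      field_simp
      ring
    linarith
  have hb : IsBdd F (ran F (enum φ)) :=
    ⟨(boundedAbove_iff hF (ran_subset _)).2 ⟨1, fun y hy => (hlt y hy).2.le⟩,
      (boundedBelow_iff hF (ran_subset _)).2 ⟨0, fun y hy => (hlt y hy).1⟩⟩
  obtain ⟨y, hy, ⟨hub, -⟩, hmax⟩ := h φ hφ hc hb
  obtain ⟨z, hz, hz1⟩ := exists_real_rat hF 1
  have hyz := (rlt_iff hy.2 hz.2).1 <| hmax z hz fun x hx =>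
    (rlt_iff hx.1.2 hz.2).2 (by rw [hz1]; exact_mod_cast (hlt x hx).2)
  rw [hz1, Rat.cast_one] at hyz
  obtain ⟨n, hn⟩ := exists_nat_one_div_lt (sub_pos.2 hyz)
  obtain ⟨x, hx, hd⟩ := exists_depth_eq_zero hα.subset (hno n)
  obtain ⟨N, hN⟩ := hcov.exists_lt_depth hα.subset hx 2
  obtain ⟨w, hw⟩ := hc.exists_value hα.subset hx
  have h1 := (rle_iff hw.1.2 hy.2).1 (hub w ((hc.mem_ran_iff hα.subset).2 ⟨x, hx, hw⟩))
  rw [hv x hx w hw] at h1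
  have h2 : 1 - 1 / ((n : ℝ) + 1) ≤ blend β (fun m => (m : ℝ) / (m + 1)) (val x) := by
    refine le_blend_of_depth_le_one hN.le (hd.trans_le zero_le_one) fun m hm _ => ?_
    have h3 : (1 : ℝ) / (m + 1) ≤ 1 / (n + 1) :=
      one_div_le_one_div_of_le (by positivity) (by exact_mod_cast Nat.succ_le_succ hm)
    have h4 : (m : ℝ) / (m + 1) = 1 - 1 / (m + 1) := by
      field_simp
      ring
    linarith
  linarith

/-- The weights `1 / (m + 1)` give a positive uniformly continuous function whose infimum
is `0`. -/
theorem heineBorel_of_posBoundedAway (hF : IsUniverse F) (hα : IsClosureOf F H α)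
    (h : ∀ φ ∈ F, EnumCont F H φ → UnifCont F H φ → PosOn F H φ → PosBoundedAway F H φ) :
    HeineBorel F H := by
  intro β hβ hcov
  by_contra! hno
  have hcomp : CompQ F fun m : ℕ => 1 / ((m : ℝ) + 1) := by
    simpa using CompQ.mkRat hF (InF.const hF 1) (InF.const hF 0) (InF.id (α := ℕ) hF)
  have hanti : Antitone fun m : ℕ => 1 / ((m : ℝ) + 1) := fun m n hmn =>
    one_div_le_one_div_of_le (by positivity) (by exact_mod_cast Nat.succ_le_succ hmn)
  obtain ⟨φ, hφ, hc, hv⟩ := exists_enumCont_blend hF hα hβ hcov hcomp fun m => by positivity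
  have hdeep : ∀ x ∈ H, ∃ n, 2 ≤ depth β n (val x) := fun x hx =>
    (hcov.exists_lt_depth hα.subset hx 2).imp fun _ => le_of_lt
  have hu : UnifCont F H φ := by
    intro m
    obtain ⟨δ, hδ, hu⟩ := blend_uniformContinuous (β := β) hanti (fun m => by positivity)
      (ε := 1 / 2 ^ m) (by
        obtain ⟨M, hM⟩ := exists_nat_one_div_lt (by positivity : 0 < 1 / (2 : ℝ) ^ m / 4)
        exact ⟨M, by linarith⟩)
    obtain ⟨n, hn⟩ := exists_one_div_two_pow_lt hδ
    refine ⟨n, fun x hx x' hx' y y' hy hy' hd => ?_⟩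
    rw [distLt_iff (hα.subset hx).2 (hα.subset hx').2] at hd
    rw [distLt_iff hy.1.2 hy'.1.2, hv x hx y hy, hv x' hx' y' hy']
    push_cast at hd ⊢
    exact hu _ _ (hdeep x hx) (hdeep x' hx') (hd.trans hn).le
  have hpos : PosOn F H φ := by
    intro x hx y hy
    obtain ⟨N, hN⟩ := hdeep x hx
    rw [ratLt_iff hy.1.2, hv x hx y hy, Rat.cast_zero]
    exact lt_of_lt_of_le (by positivity : (0 : ℝ) < 1 / (N + 1))
      (le_blend hN fun m hm _ => hanti hm.le)
  obtain ⟨m, hm⟩ := h φ hφ hc hu hpos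
  obtain ⟨n, hn⟩ := exists_nat_one_div_lt (by positivity : 0 < 1 / (2 : ℝ) ^ m)
  obtain ⟨x, hx, hd⟩ := exists_depth_eq_zero hα.subset (hno n)
  obtain ⟨N, hN⟩ := hdeep x hx
  obtain ⟨y, hy⟩ := hc.exists_value hα.subset hx
  have h1 := (ratLt_iff hy.1.2 _).1 (hm x hx y hy)
  rw [hv x hx y hy] at h1
  push_cast at h1
  have h2 : blend β (fun m : ℕ => 1 / ((m : ℝ) + 1)) (val x) ≤ 1 / (n + 1) :=
    blend_le_of_depth_le_one hN (hd.trans_le zero_le_one) fun m hm _ => hanti hm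
  linarith

/-- The `j`-th function of the sequence blends the indicator of `{m | j ≤ m}`. -/
theorem heineBorel_of_dini (hF : IsUniverse F) (hα : IsClosureOf F H α) (h : Dini F H) :
    HeineBorel F H := by
  intro β hβ hcov
  by_contra! hno
  have hcomp : CompQ F fun p : ℕ × ℕ => if p.1 ≤ p.2 then (1 : ℝ) else 0 := by
    have i0 := InF.id (α := ℕ × ℕ) hF
    have := CompQ.natCast hF
      (((i0.fst hF).sub hF (i0.snd hF)).ite hF (InF.const hF 1) (InF.const hF 0))
    convert this using 2 with p
    simp [Nat.sub_eq_zero_iff_le]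
  have h0 : ∀ p : ℕ × ℕ, 0 ≤ if p.1 ≤ p.2 then (1 : ℝ) else 0 := fun p => by
    split_ifs <;> norm_num
  obtain ⟨φ, hφ, hc⟩ := exists_enumCont_blend_rows hF hα hβ hcov hcomp h0
  have hdeep : ∀ x ∈ H, ∃ n, 2 ≤ depth β n (val x) := fun x hx =>
    (hcov.exists_lt_depth hα.subset hx 2).imp fun _ => le_of_lt
  obtain ⟨n, hn⟩ := h φ hφ (fun n => (hc n).1) (fun n x hx y y' hy hy' => by
      obtain ⟨N, hN⟩ := hdeep x hx
      rw [rle_iff hy'.1.2 hy.1.2, ratLe_iff hy'.1.2, (hc n).2 x hx y hy,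
        (hc (n + 1)).2 x hx y' hy', Rat.cast_zero]
      refine ⟨blend_mono hN fun m => ?_, le_blend hN fun m _ _ => h0 (n + 1, m)⟩
      dsimp only
      split_ifs with h1 h2
      · exact le_rfl
      · omega
      · norm_num
      · exact le_rfl) (fun m x hx => by
      obtain ⟨N, hN⟩ := hdeep x hx
      refine ⟨N, fun y hy => ?_⟩
      rw [leRat_iff hy.1.2, (hc N).2 x hx y hy]
      refine blend_le hN fun k hk _ => ?_
      rw [if_neg (not_le.2 hk)]
      positivity) 1
  obtain ⟨x, hx, hd⟩ := exists_depth_eq_zero hα.subset (hno n)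
  obtain ⟨N, hN⟩ := hdeep x hx
  obtain ⟨y, hy⟩ := (hc n).1.exists_value hα.subset hx
  have h1 := (leRat_iff hy.1.2 _).1 (hn x hx y hy)
  rw [(hc n).2 x hx y hy] at h1
  have h2 : (1 : ℝ) ≤ blend β (fun m => if n ≤ m then (1 : ℝ) else 0) (val x) :=
    le_blend_of_depth_le_one hN (hd.trans_le zero_le_one) fun m hm _ => by rw [if_pos hm]
  norm_num at h1
  linarith

/-! ### A bounded function that oscillates -/

theorem IsReal.exists_length_mul_lt {x : ℕ → ℕ} (hx : IsReal x) {C ε : ℝ} (hC : 0 ≤ C)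
    (hε : 0 < ε) : ∃ l, 2 * (C * ((hi (x l) : ℝ) - lo (x l))) < ε := by
  have hd : 0 < ε / (2 * C + 1) / 2 := by positivity
  obtain ⟨l, hl⟩ := hx.eventually (sub_lt_self _ hd) (lt_add_of_pos_right _ hd)
  obtain ⟨h1, h2⟩ := hl l le_rfl
  have h3 : ((hi (x l) : ℝ) - lo (x l)) < ε / (2 * C + 1) := by linarith
  rw [lt_div_iff₀ (by positivity)] at h3
  have h4 := (hx.lo_lt_val l).trans (hx.val_lt_hi l)
  exact ⟨l, by linarith⟩

theorem IsReal.abs_depth_sub_lo_le {x : ℕ → ℕ} (hx : IsReal x) (β : ℕ → ℕ) (n l : ℕ) :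
    |depth β n (val x) - depth β n (lo (x l))| ≤ (n * n : ℕ) * ((hi (x l) : ℝ) - lo (x l)) := by
  have h1 := hx.lo_lt_val l
  have h2 := hx.val_lt_hi l
  refine (abs_depth_sub_le β n _ _).trans ?_
  push_cast
  gcongr
  rw [abs_of_nonneg (by linarith)]
  linarith

theorem Sig.depth_row_lt (hF : IsUniverse F) (hα : IsClosureOf F H α) (hβ : β ∈ F) {ι : Type*}
    [Primcodable ι] {n i : ι → ℕ} (hn : InF F n) (hi : InF F i) (c : ℕ) :
    Sig F fun a => depth β (n a) (val (row α (i a))) < c := by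
  have h1 := (InF.id (α := ι × ℕ) hF).fst hF
  have h2 := (InF.id (α := ι × ℕ) hF).snd hF
  have hs := (InF.of_mem hα.mem).comp hF ((hi.comp hF h1).natPair hF h2)
  have hn' := hn.comp hF h1
  refine (Sig.exists hF (((CompQ.depth hF hβ hn' (CompQ.lo hF hs)).add hF
    ((CompQ.natCast hF (hn'.mul hF hn')).mul hF ((CompQ.hi hF hs).sub hF (CompQ.lo hF hs)))).sig_lt
      hF (CompQ.natCast hF (InF.const hF c)))).congr fun a => ?_
  have hr := hα.isReal (i a)
  constructor
  · intro h
    obtain ⟨l, hl⟩ := hr.exists_length_mul_lt (Nat.cast_nonneg (n a * n a)) (sub_pos.2 h)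
    have e := abs_le.1 (hr.abs_depth_sub_lo_le β (n a) l)
    refine ⟨l, ?_⟩
    dsimp only [row] at *
    linarith
  · rintro ⟨l, hl⟩
    have e := abs_le.1 (hr.abs_depth_sub_lo_le β (n a) l)
    dsimp only [row] at *
    linarith

theorem Sig.lt_depth_row (hF : IsUniverse F) (hα : IsClosureOf F H α) (hβ : β ∈ F) {ι : Type*}
    [Primcodable ι] {n i : ι → ℕ} (hn : InF F n) (hi : InF F i) (c : ℕ) :
    Sig F fun a => c < depth β (n a) (val (row α (i a))) := by
  have h1 := (InF.id (α := ι × ℕ) hF).fst hF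
  have h2 := (InF.id (α := ι × ℕ) hF).snd hF
  have hs := (InF.of_mem hα.mem).comp hF ((hi.comp hF h1).natPair hF h2)
  have hn' := hn.comp hF h1
  refine (Sig.exists hF ((CompQ.natCast hF (InF.const hF c)).sig_lt hF
    ((CompQ.depth hF hβ hn' (CompQ.lo hF hs)).sub hF ((CompQ.natCast hF (hn'.mul hF hn')).mul hF
      ((CompQ.hi hF hs).sub hF (CompQ.lo hF hs)))))).congr fun a => ?_
  have hr := hα.isReal (i a)
  constructor
  · intro h
    obtain ⟨l, hl⟩ := hr.exists_length_mul_lt (Nat.cast_nonneg (n a * n a)) (sub_pos.2 h)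
    have e := abs_le.1 (hr.abs_depth_sub_lo_le β (n a) l)
    refine ⟨l, ?_⟩
    dsimp only [row] at *
    linarith
  · rintro ⟨l, hl⟩
    have e := abs_le.1 (hr.abs_depth_sub_lo_le β (n a) l)
    dsimp only [row] at *
    linarith

theorem Sig.dist_row_lt (hF : IsUniverse F) (hα : IsClosureOf F H α) {ι : Type*}
    [Primcodable ι] {i j k : ι → ℕ} (hi : InF F i) (hj : InF F j) (hk : InF F k) :
    Sig F fun a => |val (row α (i a)) - val (row α (j a))| < 1 / 2 ^ k a := by
  have h1 := (InF.id (α := ι × ℕ) hF).fst hF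
  have h2 := (InF.id (α := ι × ℕ) hF).snd hF
  have hs := (InF.of_mem hα.mem).comp hF ((hi.comp hF h1).natPair hF h2)
  have ht := (InF.of_mem hα.mem).comp hF ((hj.comp hF h1).natPair hF h2)
  have hq := CompQ.twoPow hF (hk.comp hF h1)
  refine (Sig.exists hF ((((CompQ.hi hF hs).sub hF (CompQ.lo hF ht)).sig_lt hF hq).and hF
    (((CompQ.hi hF ht).sub hF (CompQ.lo hF hs)).sig_lt hF hq))).congr fun a => ?_
  have := distLt_iff (hα.isReal (i a)) (hα.isReal (j a)) (1 / 2 ^ k a)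
  push_cast at this
  rw [← this]
  refine exists_congr fun l => and_congr ?_ ?_ <;>
  · rw [← Rat.cast_lt (K := ℝ)]
    push_cast
    rfl

/-- Without a finite subcovering, a bounded `H` has arbitrarily close points `αⁱ`, `αʲ` of which
the second lies arbitrarily further out in the covering than the first. -/
theorem exists_close_rows (hF : IsUniverse F) (hα : IsClosureOf F H α)
    (hcov : Covers (enum β) H) (hno : ∀ n, ¬ Covers (enumUpTo β n) H) (hbdd : TotBdd H)
    (k n : ℕ) :
    ∃ n' n'' i j, |val (row α i) - val (row α j)| < 1 / 2 ^ k ∧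
      depth β n (val (row α i)) < 1 ∧ 2 < depth β n' (val (row α i)) ∧
      depth β n' (val (row α j)) < 1 ∧ 2 < depth β n'' (val (row α j)) := by
  have hdeep : ∀ i, ∃ n, 2 < depth β n (val (row α i)) := fun i => by
    obtain ⟨x, hx, he⟩ := hα.exists_row hF i
    rw [← he]
    exact hcov.exists_lt_depth hα.subset hx 2
  have hout : ∀ n, ∃ i, depth β n (val (row α i)) < 1 := fun n => by
    obtain ⟨x, hx, hd⟩ := exists_depth_eq_zero hα.subset (hno n)
    obtain ⟨i, hi⟩ := hα.approx x hx (1 / (n * n + 1)) (by positivity)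
    refine ⟨i, ?_⟩
    have e1 := abs_le.1 (abs_depth_sub_le β n (val x) (val (row α i)))
    rw [lt_div_iff₀ (by positivity)] at hi
    have e2 := abs_nonneg (val x - val (row α i))
    have e3 : (n : ℝ) * n * |val x - val (row α i)| ≤ |val x - val (row α i)| * (n * n + 1) := by
      linarith
    linarith
  choose e he using hout
  obtain ⟨M, hM⟩ := (totBdd_iff hα.subset).1 hbdd
  have hmem : ∀ n, val (row α (e n)) ∈ Set.Icc (-M) M := fun n => by
    obtain ⟨x, hx, hxe⟩ := hα.exists_row hF (e n)
    rw [← hxe]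
    exact abs_le.1 (hM x hx)
  obtain ⟨L, -, ψ, hψ, hlim⟩ := isCompact_Icc.tendsto_subseq hmem
  obtain ⟨N, hN⟩ := Metric.tendsto_atTop.1 hlim (1 / 2 ^ k / 2) (by positivity)
  obtain ⟨n', hn'⟩ := hdeep (e (ψ (max N n)))
  obtain ⟨n'', hn''⟩ := hdeep (e (ψ (max N n')))
  refine ⟨n', n'', _, _, ?_, lt_of_le_of_lt (depth_mono β _ ?_) (he (ψ (max N n))), hn',
    lt_of_le_of_lt (depth_mono β _ ?_) (he (ψ (max N n'))), hn''⟩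
  · have h1 := hN _ (le_max_left N n)
    have h2 := hN _ (le_max_left N n')
    rw [Real.dist_eq, abs_lt] at h1 h2
    simp only [Function.comp_apply] at h1 h2
    rw [abs_lt]
    constructor <;> linarith
  · exact (le_max_right N n).trans (hψ.id_le _)
  · exact (le_max_right N n').trans (hψ.id_le _)

/-- Close points are found by search, one block of stages of the covering after another. The
coefficients are `0` on the first and `1` on the second half of each block, so that the average
takes the values `0` and `1` at points that are arbitrarily close. -/
theorem heineBorel_of_unifCont (hF : IsUniverse F) (hα : IsClosureOf F H α) (hbdd : TotBdd H)
    (h : ∀ φ ∈ F, EnumCont F H φ → IsBdd F (ran F (enum φ)) → UnifCont F H φ) :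
    HeineBorel F H := by
  intro β hβ hcov
  by_contra! hno
  have i0 := InF.id (α := (ℕ × ℕ) × ℕ × ℕ) hF
  let P : (ℕ × ℕ) × ℕ × ℕ → Prop := fun a =>
    |val (row α a.2.1) - val (row α a.2.2)| < 1 / 2 ^ a.1.1.unpair.1 ∧
      depth β a.1.1.unpair.2 (val (row α a.2.1)) < (1 : ℕ) ∧
      (2 : ℕ) < depth β a.1.2.unpair.1 (val (row α a.2.1)) ∧
      depth β a.1.2.unpair.1 (val (row α a.2.2)) < (1 : ℕ) ∧
      (2 : ℕ) < depth β a.1.2.unpair.2 (val (row α a.2.2))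
  have hP : Sig F P := by
    have hk := ((i0.fst hF).fst hF).unpair hF
    have hn := ((i0.fst hF).snd hF).unpair hF
    have hi := (i0.snd hF).fst hF
    have hj := (i0.snd hF).snd hF
    exact (Sig.dist_row_lt hF hα hi hj (hk.fst hF)).and hF <|
      (Sig.depth_row_lt hF hα hβ (hk.snd hF) hi 1).and hF <|
      (Sig.lt_depth_row hF hα hβ (hn.fst hF) hi 2).and hF <|
      (Sig.depth_row_lt hF hα hβ (hn.fst hF) hj 1).and hF <|
      Sig.lt_depth_row hF hα hβ (hn.snd hF) hj 2
  have hassoc : InF F fun a : ((ℕ × ℕ) × ℕ) × ℕ => (a.1.1, a.1.2, a.2) := by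
    have j0 := InF.id (α := ((ℕ × ℕ) × ℕ) × ℕ) hF
    exact ((j0.fst hF).fst hF).prodMk hF (((j0.fst hF).snd hF).prodMk hF (j0.snd hF))
  obtain ⟨g, hg, hgs⟩ := Sig.search hF (Sig.exists hF (Sig.exists hF (hP.comp hF hassoc)))
    fun m => by
      obtain ⟨n', n'', i, j, h1, h2, h3, h4, h5⟩ :=
        exists_close_rows hF hα hcov hno hbdd m.unpair.1 m.unpair.2
      exact ⟨Nat.pair n' n'', i, j, by
        simpa only [P, Nat.unpair_pair, Nat.cast_one, Nat.cast_ofNat] using ⟨h1, h2, h3, h4, h5⟩⟩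
  -- The `k`-th block of stages is `[ν k, ν (k + 1))`; its second half begins at `μ k`.
  let ν : ℕ → ℕ := fun k => Nat.rec (motive := fun _ => ℕ) 0
    (fun k ih => (g (Nat.pair k ih)).unpair.2) k
  let μ : ℕ → ℕ := fun k => (g (Nat.pair k (ν k))).unpair.1
  have hν : InF F ν := by
    have j0 := InF.id (α := ℕ × ℕ × ℕ) hF
    exact InF.natRec hF (InF.id (α := ℕ) hF) (InF.const hF 0)
      ((((InF.of_mem hg).comp hF (((j0.snd hF).fst hF).natPair hF
        ((j0.snd hF).snd hF))).unpair hF).snd hF)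
  have hμ : InF F μ :=
    (((InF.of_mem hg).comp hF ((InF.id (α := ℕ) hF).natPair hF hν)).unpair hF).fst hF
  have hblock : ∀ k, ∃ i j, |val (row α i) - val (row α j)| < 1 / 2 ^ k ∧
      depth β (ν k) (val (row α i)) < 1 ∧ 2 < depth β (μ k) (val (row α i)) ∧
      depth β (μ k) (val (row α j)) < 1 ∧ 2 < depth β (ν (k + 1)) (val (row α j)) := by
    intro k
    obtain ⟨i, j, h1⟩ := hgs (Nat.pair k (ν k))
    refine ⟨i, j, ?_⟩
    simpa only [P, Nat.unpair_pair, Nat.cast_one, Nat.cast_ofNat] using h1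
  have hν0 : ν 0 = 0 := rfl
  clear_value μ ν
  have hνμ : ∀ k, ν k < μ k ∧ μ k < ν (k + 1) := by
    intro k
    obtain ⟨i, j, -, h1, h2, h3, h4⟩ := hblock k
    constructor
    · by_contra! hle
      linarith [depth_mono β (val (row α i)) hle]
    · by_contra! hle
      linarith [depth_mono β (val (row α j)) hle]
  have hmono : StrictMono ν := strictMono_nat_of_lt_succ fun k => (hνμ k).1.trans (hνμ k).2
  have j0 := InF.id (α := ℕ × ℕ) hF
  obtain ⟨t, ht, hts⟩ := Sig.search hF ((Sig.le hF (hν.comp hF (j0.snd hF)) (j0.fst hF)).and hF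
    (Sig.le hF ((j0.fst hF).add hF (InF.const hF 1))
      (hν.comp hF ((j0.snd hF).add hF (InF.const hF 1))))) fun m => by
    classical
    have hex : ∃ k, m + 1 ≤ ν (k + 1) := ⟨m, hmono.id_le _⟩
    refine ⟨Nat.find hex, ?_, Nat.find_spec hex⟩
    dsimp only
    rcases Nat.eq_zero_or_pos (Nat.find hex) with h0 | hpos
    · rw [h0, hν0]
      exact m.zero_le
    · have := Nat.find_min hex (Nat.sub_one_lt_of_lt hpos)
      rw [Nat.sub_add_cancel hpos] at this
      omega
  dsimp only at hts
  have htk : ∀ k m, ν k ≤ m → m < ν (k + 1) → t m = k := by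
    intro k m h1 h2
    obtain ⟨h3, h4⟩ := hts m
    have h5 := hmono.lt_iff_lt.1 (lt_of_le_of_lt h1 h4)
    have h6 := hmono.lt_iff_lt.1 (lt_of_le_of_lt h3 h2)
    omega
  let c : ℕ → ℝ := fun m => if μ (t m) ≤ m then 1 else 0
  have hc01 : ∀ m, 0 ≤ c m ∧ c m ≤ 1 := fun m => by
    simp only [c]
    split_ifs <;> norm_num
  have hcomp : CompQ F c := by
    have := CompQ.natCast hF (((hμ.comp hF (InF.of_mem ht)).sub hF (InF.id (α := ℕ) hF)).ite hF
      (InF.const hF 1) (InF.const hF 0))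
    convert this using 2 with m
    simp [c, Nat.sub_eq_zero_iff_le]
  obtain ⟨φ, hφ, hc, hv⟩ := exists_enumCont_blend hF hα hβ hcov hcomp fun m => (hc01 m).1
  have hval : ∀ y ∈ ran F (enum φ), 0 ≤ val y ∧ val y ≤ 1 := by
    intro y hy
    obtain ⟨x, hx, hy⟩ := (hc.mem_ran_iff hα.subset).1 hy
    obtain ⟨N, hN⟩ := hcov.exists_lt_depth hα.subset hx 2
    rw [hv x hx y hy]
    exact ⟨le_blend hN.le fun m _ _ => (hc01 m).1, blend_le hN.le fun m _ _ => (hc01 m).2⟩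
  obtain ⟨k, hk⟩ := h φ hφ hc
    ⟨(boundedAbove_iff hF (ran_subset _)).2 ⟨1, fun y hy => (hval y hy).2⟩,
      (boundedBelow_iff hF (ran_subset _)).2 ⟨0, fun y hy => (hval y hy).1⟩⟩ 0
  obtain ⟨i, j, h1, h2, h3, h4, h5⟩ := hblock k
  obtain ⟨x, hx, hxi⟩ := hα.exists_row hF i
  obtain ⟨x', hx', hxj⟩ := hα.exists_row hF j
  obtain ⟨y, hy⟩ := hc.exists_value hα.subset hx
  obtain ⟨y', hy'⟩ := hc.exists_value hα.subset hx'
  have hd := hk x hx x' hx' y y' hy hy' (by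
    rw [distLt_iff (hα.subset hx).2 (hα.subset hx').2, hxi, hxj]
    push_cast
    exact h1)
  rw [distLt_iff hy.1.2 hy'.1.2, hv x hx y hy, hv x' hx' y' hy', hxi, hxj, abs_lt] at hd
  have e1 : blend β c (val (row α i)) ≤ 0 := by
    refine blend_le_of_depth_le_one h3.le h2.le fun m hm hm' => ?_
    simp only [c]
    rw [htk k m hm (hm'.trans (hνμ k).2), if_neg (not_le.2 hm')]
  have e2 : 1 ≤ blend β c (val (row α j)) := by
    refine le_blend_of_depth_le_one h5.le h4.le fun m hm hm' => ?_
    simp only [c]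
    rw [htk k m ((hνμ k).1.le.trans hm) hm', if_pos hm]
  norm_num at hd
  linarith [hd.1]

end

end BIM

theorem theorem7p11 (F : Set (ℕ → ℕ)) (hF : BIM.IsUniverse F)
    (H : Set (ℕ → ℕ)) (hH : BIM.ClosedAndSeparable F H) :
    List.TFAE [
      -- (i)
      BIM.HeineBorel F H,
      -- (ii)
      ∀ φ ∈ F, BIM.EnumCont F H φ → BIM.TotBdd (BIM.ran F (BIM.enum φ)),
      -- (iii)
      BIM.TotBdd H ∧ ∀ φ ∈ F, BIM.EnumCont F H φ → BIM.UnifCont F H φ,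
      -- (iv)
      BIM.TotBdd H ∧ ∀ φ ∈ F, BIM.EnumCont F H φ → BIM.IsBdd F (BIM.ran F (BIM.enum φ)) →
        BIM.UnifCont F H φ,
      -- (v)
      ∀ φ ∈ F, BIM.EnumCont F H φ → BIM.AlmostHasMax F (BIM.ran F (BIM.enum φ)),
      -- (vi)
      ∀ φ ∈ F, BIM.EnumCont F H φ → BIM.IsBdd F (BIM.ran F (BIM.enum φ)) →
        BIM.AlmostHasMax F (BIM.ran F (BIM.enum φ)),
      -- (vii)
      ∀ φ ∈ F, BIM.EnumCont F H φ → BIM.HasLub F (BIM.ran F (BIM.enum φ)),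
      -- (viii)
      ∀ φ ∈ F, BIM.EnumCont F H φ → BIM.BoundedAbove F (BIM.ran F (BIM.enum φ)),
      -- (ix)
      ∀ φ ∈ F, BIM.EnumCont F H φ → BIM.PosOn F H φ → BIM.PosBoundedAway F H φ,
      -- (x)
      ∀ φ ∈ F, BIM.EnumCont F H φ → BIM.UnifCont F H φ → BIM.PosOn F H φ →
        BIM.PosBoundedAway F H φ,
      -- (xi)
      BIM.Dini F H] := by
  obtain ⟨α, hα⟩ := hH.exists_isClosureOf
  tfae_have 1 → 2 := fun h φ hφ hc => h.totBdd_ran hF hα hφ hc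
  tfae_have 2 → 8 := fun h φ hφ hc => by
    obtain ⟨M, hM⟩ := (BIM.totBdd_iff (BIM.ran_subset _)).1 (h φ hφ hc)
    exact (BIM.boundedAbove_iff hF (BIM.ran_subset _)).2
      ⟨M, fun y hy => (le_abs_self _).trans (hM y hy)⟩
  tfae_have 8 → 1 := BIM.heineBorel_of_boundedAbove hF hα
  tfae_have 1 → 3 := fun h => ⟨h.totBdd hF hα, fun φ hφ hc => h.unifCont hF hα hφ hc⟩
  tfae_have 3 → 4 := fun h => ⟨h.1, fun φ hφ hc _ => h.2 φ hφ hc⟩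
  tfae_have 4 → 1 := fun h => BIM.heineBorel_of_unifCont hF hα h.1 h.2
  tfae_have 1 → 5 := fun h φ hφ hc => h.almostHasMax hF hα hφ hc
  tfae_have 5 → 6 := fun h φ hφ hc _ => h φ hφ hc
  tfae_have 6 → 1 := BIM.heineBorel_of_almostHasMax hF hα
  tfae_have 5 → 7 := fun h φ hφ hc => (h φ hφ hc).imp fun _ hy => ⟨hy.1, hy.2.1⟩
  tfae_have 7 → 8 := fun h φ hφ hc => (h φ hφ hc).imp fun _ hy => ⟨hy.1, hy.2.1⟩
  tfae_have 1 → 9 := fun h φ hφ hc hpos => h.posBoundedAway hF hα hφ hc hpos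
  tfae_have 9 → 10 := fun h φ hφ hc _ hpos => h φ hφ hc hpos
  tfae_have 10 → 1 := BIM.heineBorel_of_posBoundedAway hF hα
  tfae_have 1 → 11 := fun h => h.dini hF hα
  tfae_have 11 → 1 := BIM.heineBorel_of_dini hF hα
  tfae_finish
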